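/- Let $n\ge 1$ and let $K=\{1,2\}*\{3,4\}*\cdots*\{2n-1,2n\}$ be the generalized octahedron: its simplices are the subsets of $\{1,\dots,2n\}$ containing at most one element of each pair $\{2i-1,2i\}$. Orient the maximal simplex $\{v_1<\dots<v_n\}$, $v_i\in\{2i-1,2i\}$, as $(-1)^{v_1+\cdots+v_n}[v_1\cdots v_n]$. Let $L$ be the thickening of $K$ with respect to the order $1<2<\dots<2n$: its vertices are $v:=(v,0)$ and $v':=(v,1)$ for $1\le v\le 2n$, and its simplices are the sets $\{u_1,\dots,u_a,v_1',\dots,v_b'\}$ with $u_1<\cdots<u_a\le v_1<\cdots<v_b$ (where $a=0$ or $b=0$ is allowed) such that $\{u_1,\dots,u_a,v_1,\dots,v_b\}$ is a simplex of $K$. The empty set counts as the simplex of dimension $-1$. Let $L_d$ be the set of $d$-simplices of $L$, let $C_d(L)$ be the complex vector space with the oriented $d$-simplices as an orthonormal basis (the simplex with the opposite orientation being the negative vector), let $\partial_d:C_d(L)\to C_{d-1}(L)$, $[v_0\cdots v_d]\mapsto\sum_i(-1)^i[v_0\cdots\widehat{v_i}\cdots v_d]$, and let $\Delta_{n-1}(L)=\partial_n\partial_n^\dagger+\partial_{n-1}^\dagger\partial_{n-1}$.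 For $0\le k\le n$ let $$\hat L_{n-1}^k=\{1,2\}\times\cdots\times\{2(n-k)-1,2(n-k)\}\times\{(2(n-k)+1)',(2(n-k)+2)'\}\times\cdots\times\{(2n-1)',(2n)'\}$$ be the set of $(n-1)$-simplices with one vertex over each pair, the last $k$ of them primed. For $1\le k\le n$ let $L_n^k$ be the set of $n$-simplices obtained by taking an unprimed vertex from each of the first $n-k$ pairs, both copies $v,v'$ of a vertex $v\in\{2(n-k)+1,2(n-k)+2\}$ of the next pair, and a primed vertex over each of the last $k-1$ pairs. Orient the simplices of $L$ such that (i) $\hat L_{n-1}^0$, the maximal simplices of $K\times\{0\}$, carry the orientation of $K$; (ii) for $1\le k\le n$, simplices of $\hat L_{n-1}^{k-1}$ and $\hat L_{n-1}^{k}$ induce opposite orientations on their common cofaces; (iii) for $1\le k\le n$, the simplices of $L_n^k$ carry the orientation induced by their faces in $\hat L_{n-1}^{k-1}$; all remaining simplices are oriented arbitrarily. Such an orientation exists, and for every such orientation the following hold, where $|\sigma\rangle\in C_d(L)$ denotes the oriented simplex $\sigma$. 1. Let $|c_{n-1}\rangle$ and $|c_{n-1}'\rangle$ be the sums of the maximal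 simplices of the copies $K\times\{0\}$ and $K\times\{1\}$ of $K$ in $L$, with the orientation of $K$. Then $$\partial_n\Big(\sum_{\tau\in L_n}|\tau\rangle\Big)=|c_{n-1}\rangle-|c_{n-1}'\rangle .$$ 2. Let $|\phi_{n-1}\rangle=\sum_{k=0}^n\sum_{\sigma\in\hat L_{n-1}^k}|\sigma\rangle$. Then $\ker\Delta_{n-1}(L)=\mathrm{Span}(|\phi_{n-1}\rangle)$. -/

import Mathlib

noncomputable section

namespace Octa

/-! ### Oriented chains and the combinatorial Laplacian of a simplicial complex -/

/-- The `d`-simplices of `X`. The empty simplex is the only simplex of dimension `-1`. -/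
def Simplex {V : Type*} (X : AbstractSimplicialComplex V) (d : ℤ) : Type _ :=
  {s : Finset V // (s ∈ X ∨ s = ∅) ∧ (s.card : ℤ) = d + 1}

instance {V : Type*} [Fintype V] (X : AbstractSimplicialComplex V) (d : ℤ) :
    Finite (Simplex X d) :=
  inferInstanceAs (Finite {s : Finset V // (s ∈ X ∨ s = ∅) ∧ (s.card : ℤ) = d + 1})

instance {V : Type*} [Fintype V] (X : AbstractSimplicialComplex V) (d : ℤ) :
    Fintype (Simplex X d) :=
  Fintype.ofFinite _

instance {V : Type*} [DecidableEq V] (X : AbstractSimplicialComplex V) (d : ℤ) :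
    DecidableEq (Simplex X d) :=
  inferInstanceAs (DecidableEq {s : Finset V // (s ∈ X ∨ s = ∅) ∧ (s.card : ℤ) = d + 1})

/-- The complex chain space `C_d(X)`. The simplices `[v₀ v₁ … v_d]` with `v₀ < v₁ < ⋯ < v_d`
form an orthonormal basis; the same simplex with the opposite orientation is minus that
basis vector. -/
abbrev Chain {V : Type*} (X : AbstractSimplicialComplex V) (d : ℤ) : Type _ :=
  EuclideanSpace ℂ (Simplex X d)

/-- The basis vector `[v₀ v₁ … v_d]`, `v₀ < v₁ < ⋯ < v_d`, of the `d`-simplex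
`s = {v₀, …, v_d}` of `X` (and `0` if `s` is not a `d`-simplex of `X`). -/
def ket {V : Type*} [DecidableEq V] (X : AbstractSimplicialComplex V) (d : ℤ) (s : Finset V) :
    Chain X d :=
  WithLp.toLp 2 fun t : Simplex X d => if t.1 = s then 1 else 0

/-- The coefficient of `s` in `∑ i, (-1) ^ i [v₀ … v̂ᵢ … v_d]`, where `t = {v₀ < ⋯ < v_d}`:
the sign `±1` with which `t` (vertices in increasing order) induces an orientation on its
face `s` (vertices in increasing order), and `0` if `s` is not a facet of `t`. -/
def incidence {V : Type*} [LinearOrder V] (t s : Finset V) : ℤ :=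
  ∑ v ∈ t, if t.erase v = s then (-1) ^ (t.filter (· < v)).card else 0

/-- The boundary operator `C_d(X) → C_e(X)`; only `e = d - 1` is of interest (it is zero for
all other `e`). -/
def boundary {V : Type*} [Fintype V] [LinearOrder V] (X : AbstractSimplicialComplex V)
    (d e : ℤ) : Chain X d →ₗ[ℂ] Chain X e :=
  Matrix.toEuclideanLin
    (Matrix.of fun (s : Simplex X e) (t : Simplex X d) => (incidence t.1 s.1 : ℂ))

/-- The combinatorial Laplacian
`Δ_d = δ_d† δ_d + ∂_d† ∂_d`, where `δ_d = ∂_{d+1}†`. -/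
def laplacian {V : Type*} [Fintype V] [LinearOrder V] (X : AbstractSimplicialComplex V)
    (d : ℤ) : Chain X d →ₗ[ℂ] Chain X d :=
  (boundary X (d + 1) d) ∘ₗ (LinearMap.adjoint (boundary X (d + 1) d)) +
    (LinearMap.adjoint (boundary X d (d - 1))) ∘ₗ (boundary X d (d - 1))

/-! ### The generalized octahedron and the thickening -/

/-- The generalized octahedron `{1,2} * {3,4} * ⋯ * {2n-1,2n}`. The element `v` of `Fin (2n)`
stands for the vertex `v + 1`, so `v` and `w` lie in the same pair iff `v / 2 = w / 2`. -/
def octahedron (n : ℕ) : AbstractSimplicialComplex (Fin (2 * n)) where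
  faces := {s | s.Nonempty ∧ ∀ v ∈ s, ∀ w ∈ s, (v : ℕ) / 2 = (w : ℕ) / 2 → v = w}
  isRelLowerSet_faces := fun _ hs =>
    ⟨hs.1, fun _ hts ht => ⟨ht, fun v hv w hw h => hs.2 v (hts hv) w (hts hw) h⟩⟩
  singleton_mem := fun v => ⟨Finset.singleton_nonempty v, by
    intro a ha b hb _
    rw [Finset.mem_singleton.mp ha, Finset.mem_singleton.mp hb]⟩

/-- The sign `(-1) ^ (v₁ + ⋯ + v_n)` orienting the maximal simplex `{v₁, …, v_n}` of the
generalized octahedron (vertices labelled `1, …, 2n`). -/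
def octaSign {n : ℕ} (s : Finset (Fin (2 * n))) : ℤˣ :=
  (-1) ^ (∑ v ∈ s, ((v : ℕ) + 1))

/-- The vertices `u` of `V` such that `(u, p) ∈ s`. -/
def slice {V : Type*} [Fintype V] [DecidableEq V] (p : Fin 2) (s : Finset (V ×ₗ Fin 2)) :
    Finset V :=
  Finset.univ.filter fun u => toLex (u, p) ∈ s

theorem slice_mono {V : Type*} [Fintype V] [DecidableEq V] (p : Fin 2)
    {s t : Finset (V ×ₗ Fin 2)} (h : t ⊆ s) : slice p t ⊆ slice p s := by
  intro u hu
  simp only [slice, Finset.mem_filter, Finset.mem_univ, true_and] at hu ⊢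
  exact h hu

theorem slice_union_nonempty {V : Type*} [Fintype V] [DecidableEq V]
    {s : Finset (V ×ₗ Fin 2)} (h : s.Nonempty) : (slice 0 s ∪ slice 1 s).Nonempty := by
  obtain ⟨x, hx⟩ := h
  obtain ⟨⟨u, p⟩, rfl⟩ := toLex.surjective x
  refine ⟨u, ?_⟩
  simp only [slice, Finset.mem_union, Finset.mem_filter, Finset.mem_univ, true_and]
  fin_cases p
  · exact Or.inl hx
  · exact Or.inr hx

/-- The thickening of `K` with respect to the order of its vertices: the simplices are
`{(u₁,0), …, (u_a,0), (v₁,1), …, (v_b,1)}` with `u₁ < ⋯ < u_a ≤ v₁ < ⋯ < v_b` (where `a = 0` or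
`b = 0` is allowed) such that `{u₁, …, u_a, v₁, …, v_b}` is a simplex of `K`.
The vertices are ordered lexicographically; on every simplex this is the order in which
its vertices are listed here. -/
def thickening {V : Type*} [Fintype V] [LinearOrder V] (K : AbstractSimplicialComplex V) :
    AbstractSimplicialComplex (V ×ₗ Fin 2) where
  faces := {s | s.Nonempty ∧ (∀ u ∈ slice 0 s, ∀ v ∈ slice 1 s, u ≤ v) ∧
    slice 0 s ∪ slice 1 s ∈ K}
  isRelLowerSet_faces := fun _ hs =>
    ⟨hs.1, fun _ hts ht =>
      ⟨ht, fun u hu v hv => hs.2.1 u (slice_mono 0 hts hu) v (slice_mono 1 hts hv),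
        (K.isRelLowerSet_faces hs.2.2).2
          (Finset.union_subset_union (slice_mono 0 hts) (slice_mono 1 hts))
          (slice_union_nonempty ht)⟩⟩
  singleton_mem := fun x => by
    obtain ⟨⟨u, p⟩, rfl⟩ := toLex.surjective x
    refine ⟨Finset.singleton_nonempty _, ?_, ?_⟩
    · intro a ha b hb
      simp only [slice, Finset.mem_filter, Finset.mem_univ, true_and, Finset.mem_singleton,
        EmbeddingLike.apply_eq_iff_eq, Prod.mk.injEq] at ha hb
      rw [ha.1, hb.1]
    · have h : slice 0 {toLex (u, p)} ∪ slice 1 {toLex (u, p)} = ({u} : Finset V) := by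
        ext w
        simp only [slice, Finset.mem_union, Finset.mem_filter, Finset.mem_univ, true_and,
          Finset.mem_singleton, EmbeddingLike.apply_eq_iff_eq, Prod.mk.injEq]
        fin_cases p <;> simp
      rw [h]
      exact K.singleton_mem u

/-- The complex `L` gluing two copies of the generalized octahedron. -/
abbrev glued (n : ℕ) : AbstractSimplicialComplex (Fin (2 * n) ×ₗ Fin 2) :=
  thickening (octahedron n)

/-- The copy `s × {p}` of a simplex `s`. -/
def copy {n : ℕ} (p : Fin 2) (s : Finset (Fin (2 * n))) : Finset (Fin (2 * n) ×ₗ Fin 2) :=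
  s.image fun v => toLex (v, p)

/-! ### The layers of the glued complex -/

/-- The `b`-th vertex of the `i`-th pair. -/
def vertex {n : ℕ} (i : Fin n) (b : Fin 2) : Fin (2 * n) :=
  ⟨2 * i + b, by omega⟩

/-- The layer of `(n-1)`-simplices (`0 ≤ k ≤ n`) in which the vertices of the last `k` pairs
are primed: `{1,2} × ⋯ × {2(n-k)-1, 2(n-k)} × {(2(n-k)+1)', (2(n-k)+2)'} × ⋯ × {(2n-1)', (2n)'}`. -/
def hatLayer (n k : ℕ) : Finset (Finset (Fin (2 * n) ×ₗ Fin 2)) :=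
  Finset.univ.image fun x : Fin n → Fin 2 =>
    Finset.univ.image fun i : Fin n =>
      (toLex (vertex i (x i), if (i : ℕ) + k < n then 0 else 1) : Fin (2 * n) ×ₗ Fin 2)

/-- The set of `n`-simplices (`1 ≤ k ≤ n`) that have one vertex in each of the first `n - k`
pairs, both copies of a vertex of the next pair, and one primed vertex in each of the last
`k - 1` pairs. -/
def layer (n k : ℕ) : Finset (Finset (Fin (2 * n) ×ₗ Fin 2)) :=
  Finset.univ.image fun x : Fin n → Fin 2 =>
    ((Finset.univ.filter fun i : Fin n => (i : ℕ) + k ≤ n).image fun i =>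
        (toLex (vertex i (x i), 0) : Fin (2 * n) ×ₗ Fin 2)) ∪
      ((Finset.univ.filter fun i : Fin n => n ≤ (i : ℕ) + k).image fun i =>
        (toLex (vertex i (x i), 1) : Fin (2 * n) ×ₗ Fin 2))

/-- An orientation of the simplices of `L` is recorded by a sign `o s` for each vertex set `s`:
the oriented simplex is `o s` times the simplex with vertices in increasing order. The
orientations of `L` in question are those for which
* the copy `K × {0}` carries the orientation of the generalized octahedron;
* simplices of consecutive layers `hatLayer n k`, `hatLayer n (k + 1)` induce opposite
  orientations on their common cofaces;
* the simplices of `layer n (k + 1)` carry the orientation induced by their faces in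
  `hatLayer n k`.
The orientation of all other simplices is arbitrary. -/
structure IsLayerOrientation (n : ℕ) (o : Finset (Fin (2 * n) ×ₗ Fin 2) → ℤˣ) : Prop where
  base : ∀ s ∈ octahedron n, s.card = n → o (copy 0 s) = octaSign s
  opposite : ∀ k < n, ∀ s ∈ hatLayer n k, ∀ s' ∈ hatLayer n (k + 1), ∀ t ∈ glued n,
    t.card = n + 1 → s ⊆ t → s' ⊆ t →
      (o s : ℤ) * incidence t s = -((o s' : ℤ) * incidence t s')
  induced : ∀ k < n, ∀ t ∈ layer n (k + 1), ∀ s ∈ hatLayer n k, s ⊆ t →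
    (o t : ℤ) = (o s : ℤ) * incidence t s

/-- The cycle `∑ |σ⟩`, over the maximal simplices `σ` of the generalized octahedron with
their orientation, in the copy `K × {p}` inside `L`. -/
def octaCycle (n : ℕ) (p : Fin 2) : Chain (glued n) ((n : ℤ) - 1) :=
  ∑ s : Simplex (octahedron n) ((n : ℤ) - 1),
    ((octaSign s.1 : ℤ) : ℂ) • ket (glued n) ((n : ℤ) - 1) (copy p s.1)

/-- The sum of all `n`-simplices of `L`, oriented by `o`. -/
def topSum (n : ℕ) (o : Finset (Fin (2 * n) ×ₗ Fin 2) → ℤˣ) : Chain (glued n) (n : ℤ) :=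
  ∑ t : Simplex (glued n) (n : ℤ), ((o t.1 : ℤ) : ℂ) • ket (glued n) (n : ℤ) t.1

/-- The sum of all simplices in the layers `hatLayer n 0, …, hatLayer n n`, oriented by `o`. -/
def harmonic (n : ℕ) (o : Finset (Fin (2 * n) ×ₗ Fin 2) → ℤˣ) :
    Chain (glued n) ((n : ℤ) - 1) :=
  ∑ k ∈ Finset.range (n + 1), ∑ s ∈ hatLayer n k,
    ((o s : ℤ) : ℂ) • ket (glued n) ((n : ℤ) - 1) s

end Octa

end

/-!
The kernel of the Laplacian is the intersection of the kernels of the boundary and of its adjoint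
(`ker_laplacian`), and all computations are done with coefficients of chains at vertex sets, so
that the boundary at `s` is a signed sum over the vertices that can be added to `s`
(`coef_boundary`).

An `n`-simplex of the glued complex has exactly one doubled vertex `v`, `v'`. Its two faces without
`v` and without `v'` have one vertex over each pair, lie in consecutive layers and have opposite
incidence numbers, as `v` and `v'` are consecutive in the vertex order. Hence an admissible
orientation gives each simplex with one vertex over each pair the orientation of its image in the
octahedron, and each `n`-simplex with `c` unprimed vertices that of its image times `(-1) ^ c`
(`isLayerOrientation_stdSign`, `IsLayerOrientation.eq_of_isHat`, `IsLayerOrientation.eq_of_top`).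

In the boundary of the sum of all `n`-simplices, the coefficient of a simplex with one vertex over
each pair has a contribution from doubling its least primed vertex and an opposite one from
doubling its greatest unprimed vertex; only one of them exists exactly when the simplex lies in
one of the two copies of the octahedron. At every other `(n-1)`-simplex some pair is
empty, and the two ways of filling it cancel (`sum_posSign_eq_zero`), because exchanging the
vertices of a pair reverses the orientation of the octahedron and preserves positions. The same
cancellation shows that the harmonic chain is a cycle; it is a cocycle because the two relevant
faces of an `n`-simplex have opposite incidence numbers.

It remains to see that the kernel has dimension at most one. In the thickening of any complex,
adding `v` to a simplex with least primed vertex `v'` is an acyclic matching whose unmatched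
simplices are those of the unprimed copy, so every cycle is homologous to a cycle on that copy
(`exists_unprimed_cycle`). A cycle of dimension `n - 1` on the octahedron is determined by
one coefficient (`unprimed_cycle_eq_zero`). So some combination of a given kernel element and the
harmonic chain is a boundary; being also in the kernel of the adjoint, it is zero.
-/

namespace Octa

/-! ### Chains in coordinates -/

section Chains

variable {V : Type*} [LinearOrder V]

/-- The coefficient of a chain at an arbitrary vertex set, which is `0` at the sets that are not
`d`-simplices. This makes it possible to sum over vertices instead of simplices. -/
noncomputable def coef {X : AbstractSimplicialComplex V} {d : ℤ} (ψ : Chain X d)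
    (r : Finset V) : ℂ :=
  open Classical in if h : (r ∈ X ∨ r = ∅) ∧ (r.card : ℤ) = d + 1 then ψ ⟨r, h⟩ else 0

/-- The number of vertices of `s` below `v` as a sign: for `v ∉ s` this is the incidence number
of `insert v s` and `s`. -/
def posSign (s : Finset V) (v : V) : ℤ := (-1) ^ (s.filter (· < v)).card

@[simp]
theorem coef_val {X : AbstractSimplicialComplex V} {d : ℤ} (ψ : Chain X d) (s : Simplex X d) :
    coef ψ s.1 = ψ s := by
  rw [coef, dif_pos s.2]
  rfl

theorem coef_of_not {X : AbstractSimplicialComplex V} {d : ℤ} (ψ : Chain X d) {r : Finset V}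
    (h : ¬ ((r ∈ X ∨ r = ∅) ∧ (r.card : ℤ) = d + 1)) : coef ψ r = 0 := by
  rw [coef, dif_neg h]

theorem chain_ext {X : AbstractSimplicialComplex V} {d : ℤ} {ψ φ : Chain X d}
    (h : ∀ s : Simplex X d, coef ψ s.1 = coef φ s.1) : ψ = φ := by
  ext s
  simpa using h s

theorem coef_add {X : AbstractSimplicialComplex V} {d : ℤ} (ψ φ : Chain X d) (r : Finset V) :
    coef (ψ + φ) r = coef ψ r + coef φ r := by
  unfold coef
  split_ifs
  · rfl
  · simp

theorem coef_sub {X : AbstractSimplicialComplex V} {d : ℤ} (ψ φ : Chain X d) (r : Finset V) :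
    coef (ψ - φ) r = coef ψ r - coef φ r := by
  unfold coef
  split_ifs
  · rfl
  · simp

theorem coef_smul {X : AbstractSimplicialComplex V} {d : ℤ} (a : ℂ) (ψ : Chain X d)
    (r : Finset V) : coef (a • ψ) r = a * coef ψ r := by
  unfold coef
  split_ifs
  · rfl
  · simp

@[simp]
theorem coef_zero {X : AbstractSimplicialComplex V} {d : ℤ} (r : Finset V) :
    coef (0 : Chain X d) r = 0 := by
  unfold coef
  split_ifs
  · rfl
  · simp

theorem coef_sum {X : AbstractSimplicialComplex V} {d : ℤ} {ι : Type*} (S : Finset ι)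
    (f : ι → Chain X d) (r : Finset V) : coef (∑ i ∈ S, f i) r = ∑ i ∈ S, coef (f i) r := by
  classical
  induction S using Finset.induction_on with
  | empty => simp
  | insert a S ha ih => rw [Finset.sum_insert ha, Finset.sum_insert ha, coef_add, ih]

theorem coef_ket {X : AbstractSimplicialComplex V} {d : ℤ} (r : Finset V) (s : Simplex X d) :
    coef (ket X d r) s.1 = if s.1 = r then 1 else 0 := by
  rw [coef_val]
  rfl

theorem posSign_ne_zero (s : Finset V) (v : V) : posSign s v ≠ 0 := by
  simp [posSign]

/-- Vertices in the same position relative to `s` have the same sign. -/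
theorem posSign_congr {s : Finset V} {v w : V} (h : ∀ x ∈ s, x < v ↔ x < w) :
    posSign s v = posSign s w := by
  rw [posSign, posSign, Finset.filter_congr h]

theorem posSign_insert {s : Finset V} {u : V} (hu : u ∉ s) (v : V) :
    posSign (insert u s) v = (if u < v then -1 else 1) * posSign s v := by
  rw [posSign, posSign, Finset.filter_insert]
  split_ifs with h
  · rw [Finset.card_insert_of_notMem (by simp [hu]), pow_succ]
    ring
  · simp

theorem incidence_erase {t : Finset V} {v : V} (hv : v ∈ t) :
    incidence t (t.erase v) = posSign t v := by
  rw [incidence, Finset.sum_eq_single v]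
  · simp [posSign]
  · intro w hw hwv
    rw [if_neg]
    intro h
    have : w ∈ t.erase v := Finset.mem_erase.2 ⟨hwv, hw⟩
    rw [← h] at this
    simp at this
  · exact fun h => absurd hv h

theorem incidence_insert {s : Finset V} {v : V} (hv : v ∉ s) :
    incidence (insert v s) s = posSign s v := by
  have h := incidence_erase (Finset.mem_insert_self v s)
  rw [Finset.erase_insert hv, posSign_insert hv] at h
  simpa using h

theorem exists_erase_of_incidence_ne_zero {t s : Finset V} (h : incidence t s ≠ 0) :
    ∃ v ∈ t, s = t.erase v := by
  obtain ⟨v, hv, hne⟩ := Finset.exists_ne_zero_of_sum_ne_zero h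
  refine ⟨v, hv, ?_⟩
  by_contra hs
  rw [if_neg (fun h => hs h.symm)] at hne
  exact hne rfl

variable [Fintype V]

theorem sum_ite_eq_coef {X : AbstractSimplicialComplex V} {d : ℤ} (ψ : Chain X d)
    (r : Finset V) : (∑ t : Simplex X d, if t.1 = r then ψ t else 0) = coef ψ r := by
  classical
  by_cases h : (r ∈ X ∨ r = ∅) ∧ (r.card : ℤ) = d + 1
  · obtain ⟨s, rfl⟩ : ∃ s : Simplex X d, s.1 = r := ⟨⟨r, h⟩, rfl⟩
    rw [coef_val, Finset.sum_eq_single s]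
    · simp
    · intro b _ hb
      rw [if_neg]
      exact fun hb2 => hb (Subtype.ext hb2)
    · simp
  · rw [coef_of_not ψ h]
    refine Finset.sum_eq_zero fun t _ => ?_
    rw [if_neg]
    rintro rfl
    exact h t.2

theorem coef_sum_ket {X : AbstractSimplicialComplex V} {d : ℤ} (c : Finset V → ℂ)
    (s : Simplex X d) : coef (∑ t : Simplex X d, c t.1 • ket X d t.1) s.1 = c s.1 := by
  simp_rw [coef_sum, coef_smul, coef_ket]
  rw [Finset.sum_eq_single s]
  · simp
  · intro b _ hb
    rw [if_neg fun h => hb (Subtype.ext h.symm), mul_zero]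
  · simp

theorem chain_eq_sum_ket {X : AbstractSimplicialComplex V} {d : ℤ} (ψ : Chain X d) :
    ψ = ∑ s : Simplex X d, coef ψ s.1 • ket X d s.1 :=
  chain_ext fun t => (coef_sum_ket (coef ψ) t).symm

/-- The boundary, as a sum over the vertices that can be added to `s`. -/
theorem boundary_apply {X : AbstractSimplicialComplex V} {d e : ℤ} (ψ : Chain X d)
    (s : Simplex X e) : boundary X d e ψ s =
      ∑ v ∈ s.1ᶜ, (posSign s.1 v : ℂ) * coef ψ (insert v s.1) := by
  have h1 : boundary X d e ψ s = ∑ t : Simplex X d, (incidence t.1 s.1 : ℂ) * ψ t := rfl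
  have h2 : ∀ t : Simplex X d, (incidence t.1 s.1 : ℂ) * ψ t =
      ∑ v ∈ s.1ᶜ, if t.1 = insert v s.1 then (posSign s.1 v : ℂ) * ψ t else 0 := by
    intro t
    by_cases h : ∃ v ∈ s.1ᶜ, t.1 = insert v s.1
    · obtain ⟨v, hv, hvt⟩ := h
      rw [Finset.mem_compl] at hv
      rw [Finset.sum_eq_single v, if_pos hvt, hvt, incidence_insert hv]
      · intro w hw hwv
        rw [if_neg]
        rw [hvt]
        intro h
        have : w ∈ insert v s.1 := h ▸ Finset.mem_insert_self w s.1
        rw [Finset.mem_compl] at hw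
        simp [hwv, hw] at this
      · exact fun h => absurd (Finset.mem_compl.2 hv) h
    · rw [Finset.sum_eq_zero]
      · by_cases h0 : incidence t.1 s.1 = 0
        · simp [h0]
        · obtain ⟨v, hv, hs⟩ := exists_erase_of_incidence_ne_zero h0
          exact absurd ⟨v, by simp [hs], by rw [hs, Finset.insert_erase hv]⟩ h
      · intro v hv
        rw [if_neg fun hvt => h ⟨v, hv, hvt⟩]
  rw [h1, Finset.sum_congr rfl fun t _ => h2 t, Finset.sum_comm]
  refine Finset.sum_congr rfl fun v _ => ?_
  rw [← sum_ite_eq_coef, Finset.mul_sum]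
  exact Finset.sum_congr rfl fun t _ => by split_ifs <;> simp

/-- The formula for the boundary holds at every vertex set: both sides vanish at sets that are
not simplices. -/
theorem coef_boundary {X : AbstractSimplicialComplex V} {d e : ℤ} (hde : d = e + 1)
    (ψ : Chain X d) (r : Finset V) : coef (boundary X d e ψ) r =
      ∑ v ∈ rᶜ, (posSign r v : ℂ) * coef ψ (insert v r) := by
  by_cases h : (r ∈ X ∨ r = ∅) ∧ (r.card : ℤ) = e + 1
  · obtain ⟨s, rfl⟩ : ∃ s : Simplex X e, s.1 = r := ⟨⟨r, h⟩, rfl⟩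
    rw [coef_val, boundary_apply]
  · rw [coef_of_not _ h, Finset.sum_eq_zero]
    intro v hv
    rw [coef_of_not, mul_zero]
    rintro ⟨hf, hc⟩
    rw [Finset.mem_compl] at hv
    rw [Finset.card_insert_of_notMem hv] at hc
    refine h ⟨?_, by push_cast at hc; omega⟩
    rcases hf with hf | hf
    · rcases r.eq_empty_or_nonempty with hr | hr
      · exact Or.inr hr
      · exact Or.inl ((X.isRelLowerSet_faces hf).2 (Finset.subset_insert v r) hr)
    · simp at hf

theorem boundary_boundary {X : AbstractSimplicialComplex V} {d e f : ℤ} (hde : d = e + 1)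
    (hef : e = f + 1) (ψ : Chain X d) : boundary X e f (boundary X d e ψ) = 0 := by
  refine chain_ext fun r => ?_
  rw [coef_boundary hef, coef_zero]
  obtain ⟨r, -⟩ := r
  change ∑ v ∈ rᶜ, (posSign r v : ℂ) * coef (boundary X d e ψ) (insert v r) = 0
  simp_rw [coef_boundary hde, Finset.mul_sum]
  rw [Finset.sum_sigma']
  refine Finset.sum_involution (fun x _ => ⟨x.2, x.1⟩) ?_ ?_ ?_ ?_
  · rintro ⟨u, v⟩ h
    simp only [Finset.mem_sigma, Finset.mem_compl, Finset.mem_insert, not_or] at h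
    rw [posSign_insert h.1, posSign_insert h.2.2, Finset.insert_comm]
    rcases lt_or_gt_of_ne h.2.1 with huv | huv
    · simp only [huv, huv.not_gt, if_true, if_false]
      push_cast
      ring
    · simp only [huv, huv.not_gt, if_true, if_false]
      push_cast
      ring
  · rintro ⟨u, v⟩ h - heq
    simp only [Finset.mem_sigma, Finset.mem_compl, Finset.mem_insert, not_or] at h
    exact h.2.1 (congrArg Sigma.fst heq)
  · rintro ⟨u, v⟩ h
    simp only [Finset.mem_sigma, Finset.mem_compl, Finset.mem_insert, not_or] at h ⊢
    exact ⟨h.2.2, fun h' => h.2.1 h'.symm, h.1⟩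
  · rintro ⟨u, v⟩ _
    rfl

/-- The adjoint of the boundary, as a sum over the vertices that can be removed from `t`. -/
theorem adjoint_boundary_apply {X : AbstractSimplicialComplex V} {d e : ℤ} (φ : Chain X e)
    (t : Simplex X d) : LinearMap.adjoint (boundary X d e) φ t =
      ∑ v ∈ t.1, (posSign t.1 v : ℂ) * coef φ (t.1.erase v) := by
  have h1 : LinearMap.adjoint (boundary X d e) φ t =
      ∑ s : Simplex X e, (incidence t.1 s.1 : ℂ) * φ s := by
    rw [boundary, ← Matrix.toEuclideanLin_conjTranspose_eq_adjoint]
    simp [Matrix.toLpLin_apply, Matrix.mulVec, dotProduct]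
  rw [h1]
  simp_rw [incidence, Int.cast_sum, Finset.sum_mul]
  rw [Finset.sum_comm]
  refine Finset.sum_congr rfl fun v _ => ?_
  rw [← sum_ite_eq_coef, Finset.mul_sum]
  refine Finset.sum_congr rfl fun s _ => ?_
  by_cases h : t.1.erase v = s.1
  · rw [if_pos h, if_pos h.symm, posSign]
  · rw [if_neg h, if_neg fun h' => h h'.symm]
    simp

theorem ker_laplacian (X : AbstractSimplicialComplex V) (d : ℤ) :
    LinearMap.ker (laplacian X d) =
      LinearMap.ker (LinearMap.adjoint (boundary X (d + 1) d)) ⊓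
        LinearMap.ker (boundary X d (d - 1)) := by
  ext x
  rw [Submodule.mem_inf, LinearMap.mem_ker, LinearMap.mem_ker, LinearMap.mem_ker]
  constructor
  · intro h
    have h2 : inner ℂ x (laplacian X d x) = 0 := by rw [h, inner_zero_right]
    simp only [laplacian, LinearMap.add_apply, LinearMap.comp_apply, inner_add_right] at h2
    rw [← LinearMap.adjoint_inner_left (boundary X (d + 1) d),
      LinearMap.adjoint_inner_right (boundary X d (d - 1)),
      inner_self_eq_norm_sq_to_K, inner_self_eq_norm_sq_to_K] at h2
    norm_cast at h2
    rw [RCLike.ofReal_eq_zero] at h2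
    have h3 := sq_nonneg ‖LinearMap.adjoint (boundary X (d + 1) d) x‖
    have h4 := sq_nonneg ‖boundary X d (d - 1) x‖
    exact ⟨norm_eq_zero.1 (pow_eq_zero_iff two_ne_zero |>.1 (by linarith)),
      norm_eq_zero.1 (pow_eq_zero_iff two_ne_zero |>.1 (by linarith))⟩
  · rintro ⟨h1, h2⟩
    simp [laplacian, h1, h2]

/-- A boundary that is orthogonal to all boundaries is zero. -/
theorem eq_zero_of_mem_range_boundary {X : AbstractSimplicialComplex V} {d e : ℤ} {x : Chain X e}
    (h : x ∈ LinearMap.range (boundary X d e))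
    (h' : LinearMap.adjoint (boundary X d e) x = 0) : x = 0 := by
  obtain ⟨y, rfl⟩ := h
  rw [← inner_self_eq_zero (𝕜 := ℂ), ← LinearMap.adjoint_inner_right, h', inner_zero_right]

end Chains

/-! ### Cycles of a thickening are homologous to cycles of its unprimed copy -/

section Thickening

variable {V : Type*}

/-- The unprimed copy of the vertex `v`. -/
def lo (v : V) : V ×ₗ Fin 2 := toLex (v, 0)

/-- The primed copy of the vertex `v`. -/
def hi (v : V) : V ×ₗ Fin 2 := toLex (v, 1)

@[simp] theorem lo_inj {v w : V} : lo v = lo w ↔ v = w := by simp [lo]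

@[simp] theorem hi_inj {v w : V} : hi v = hi w ↔ v = w := by simp [hi]

@[simp] theorem lo_ne_hi (v w : V) : lo v ≠ hi w := by simp [lo, hi]

@[simp] theorem hi_ne_lo (v w : V) : hi v ≠ lo w := by simp [lo, hi]

theorem lo_or_hi (a : V ×ₗ Fin 2) : ∃ v, a = lo v ∨ a = hi v := by
  obtain ⟨⟨u, p⟩, rfl⟩ := toLex.surjective a
  refine ⟨u, ?_⟩
  fin_cases p
  · exact Or.inl rfl
  · exact Or.inr rfl

variable [Fintype V] [LinearOrder V]

@[simp] theorem mem_slice_zero {s : Finset (V ×ₗ Fin 2)} {v : V} : v ∈ slice 0 s ↔ lo v ∈ s := by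
  simp [slice, lo]

@[simp] theorem mem_slice_one {s : Finset (V ×ₗ Fin 2)} {v : V} : v ∈ slice 1 s ↔ hi v ∈ s := by
  simp [slice, hi]

/-- The vertices of the base complex over which `s` lies. -/
def support (s : Finset (V ×ₗ Fin 2)) : Finset V := slice 0 s ∪ slice 1 s

theorem mem_support {s : Finset (V ×ₗ Fin 2)} {v : V} : v ∈ support s ↔ lo v ∈ s ∨ hi v ∈ s := by
  simp [support]

theorem slice_zero_insert_lo (s : Finset (V ×ₗ Fin 2)) (v : V) :
    slice 0 (insert (lo v) s) = insert v (slice 0 s) := by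
  ext; simp

theorem slice_one_insert_lo (s : Finset (V ×ₗ Fin 2)) (v : V) :
    slice 1 (insert (lo v) s) = slice 1 s := by
  ext; simp

theorem slice_zero_insert_hi (s : Finset (V ×ₗ Fin 2)) (v : V) :
    slice 0 (insert (hi v) s) = slice 0 s := by
  ext; simp

theorem slice_zero_erase_lo (s : Finset (V ×ₗ Fin 2)) (v : V) :
    slice 0 (s.erase (lo v)) = (slice 0 s).erase v := by
  ext; simp

theorem slice_one_erase_lo (s : Finset (V ×ₗ Fin 2)) (v : V) :
    slice 1 (s.erase (lo v)) = slice 1 s := by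
  ext; simp

theorem slice_zero_erase_hi (s : Finset (V ×ₗ Fin 2)) (v : V) :
    slice 0 (s.erase (hi v)) = slice 0 s := by
  ext; simp

theorem slice_one_erase_hi (s : Finset (V ×ₗ Fin 2)) (v : V) :
    slice 1 (s.erase (hi v)) = (slice 1 s).erase v := by
  ext; simp

theorem support_eq_empty {s : Finset (V ×ₗ Fin 2)} : support s = ∅ ↔ s = ∅ := by
  constructor
  · intro h
    rw [Finset.eq_empty_iff_forall_notMem] at h ⊢
    intro a ha
    obtain ⟨v, rfl | rfl⟩ := lo_or_hi a
    · exact h v (mem_support.2 (Or.inl ha))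
    · exact h v (mem_support.2 (Or.inr ha))
  · rintro rfl
    ext; simp [mem_support]

/-- Simplices of a thickening, the empty one included. -/
theorem mem_thickening_or_empty {K : AbstractSimplicialComplex V} {s : Finset (V ×ₗ Fin 2)} :
    (s ∈ thickening K ∨ s = ∅) ↔ (∀ u, lo u ∈ s → ∀ v, hi v ∈ s → u ≤ v) ∧
      (support s ∈ K ∨ support s = ∅) := by
  have h1 : s ∈ thickening K ↔ s.Nonempty ∧ (∀ u ∈ slice 0 s, ∀ v ∈ slice 1 s, u ≤ v) ∧
    slice 0 s ∪ slice 1 s ∈ K := Iff.rfl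
  rw [support_eq_empty, h1]
  simp only [mem_slice_zero, mem_slice_one]
  constructor
  · rintro (⟨-, h, h'⟩ | rfl)
    · exact ⟨h, Or.inl h'⟩
    · simp
  · rintro ⟨h, h' | h'⟩
    · rcases s.eq_empty_or_nonempty with h0 | h0
      · exact Or.inr h0
      · exact Or.inl ⟨h0, h, h'⟩
    · exact Or.inr h'

theorem card_slice_add (s : Finset (V ×ₗ Fin 2)) :
    s.card = (slice 0 s).card + (slice 1 s).card := by
  have h : s = (slice 0 s).image lo ∪ (slice 1 s).image hi := by
    ext a
    obtain ⟨v, rfl | rfl⟩ := lo_or_hi a <;> simp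
  conv_lhs => rw [h]
  rw [Finset.card_union_of_disjoint, Finset.card_image_of_injective _ fun _ _ => lo_inj.1,
    Finset.card_image_of_injective _ fun _ _ => hi_inj.1]
  rw [Finset.disjoint_left]
  intro a ha hb
  rw [Finset.mem_image] at ha hb
  obtain ⟨v, -, rfl⟩ := ha
  obtain ⟨w, -, h⟩ := hb
  exact hi_ne_lo _ _ h

/-- The simplices whose least primed vertex `v'` is present without its unprimed copy `v`.
Adding `v` matches them with the simplices whose least primed vertex is doubled; the unmatched
simplices are those without primed vertices. -/
def IsLower (s : Finset (V ×ₗ Fin 2)) : Prop :=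
  ∃ v, hi v ∈ s ∧ lo v ∉ s ∧ ∀ w, hi w ∈ s → v ≤ w

/-- The chains that vanish on all simplices satisfying `IsLower`. -/
def upperChains (K : AbstractSimplicialComplex V) (d : ℤ) :
    Submodule ℂ (Chain (thickening K) d) where
  carrier := {ψ | ∀ s, IsLower s → coef ψ s = 0}
  add_mem' hψ hφ s hs := by rw [coef_add, hψ s hs, hφ s hs, add_zero]
  zero_mem' s _ := coef_zero s
  smul_mem' a ψ hψ s hs := by rw [coef_smul, hψ s hs, mul_zero]

theorem mem_upperChains {K : AbstractSimplicialComplex V} {d : ℤ} {ψ : Chain (thickening K) d} :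
    ψ ∈ upperChains K d ↔ ∀ s, IsLower s → coef ψ s = 0 := Iff.rfl

/-- Modulo boundaries every simplex is a combination of simplices that are not lower: a lower
simplex `s` with least primed vertex `v'` is a face of `insert (lo v) s`, whose other lower faces
have fewer primed vertices. -/
theorem ket_mem_upperChains_sup_range {K : AbstractSimplicialComplex V} {d : ℤ} (m : ℕ) :
    ∀ s : Simplex (thickening K) d, (slice 1 s.1).card ≤ m → ket (thickening K) d s.1 ∈
      upperChains K d ⊔ LinearMap.range (boundary (thickening K) (d + 1) d) := by
  induction m using Nat.strong_induction_on with
  | _ m ih =>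
  intro s hsm
  have upper : ∀ s : Simplex (thickening K) d, ¬ IsLower s.1 → ket (thickening K) d s.1 ∈
      upperChains K d ⊔ LinearMap.range (boundary (thickening K) (d + 1) d) := by
    intro s hs
    refine Submodule.mem_sup_left (mem_upperChains.2 fun r hr => ?_)
    by_cases h : (r ∈ thickening K ∨ r = ∅) ∧ (r.card : ℤ) = d + 1
    · obtain ⟨r, rfl⟩ : ∃ t : Simplex (thickening K) d, t.1 = r := ⟨⟨r, h⟩, rfl⟩
      rw [coef_ket, if_neg]
      intro h
      exact hs (h ▸ hr)
    · exact coef_of_not _ h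
  by_cases hs : IsLower s.1
  swap
  · exact upper s hs
  obtain ⟨v, hv, hv0, hmin⟩ := hs
  have hface := mem_thickening_or_empty.1 s.2.1
  have htface : (insert (lo v) s.1 ∈ thickening K ∨ insert (lo v) s.1 = ∅) ∧
      ((insert (lo v) s.1).card : ℤ) = d + 1 + 1 := by
    refine ⟨mem_thickening_or_empty.2 ⟨?_, ?_⟩, ?_⟩
    · intro u hu w hw
      simp only [Finset.mem_insert, lo_inj, hi_ne_lo, false_or] at hu hw
      rcases hu with rfl | hu
      · exact hmin w hw
      · exact hface.1 u hu w hw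
    · have : support (insert (lo v) s.1) = support s.1 := by
        rw [support, slice_zero_insert_lo, slice_one_insert_lo, Finset.insert_union,
          Finset.insert_eq_of_mem]
        · rfl
        · simp [hv]
      rw [this]
      exact hface.2
    · rw [Finset.card_insert_of_notMem hv0]
      push_cast
      rw [s.2.2]
  obtain ⟨t, ht⟩ : ∃ t : Simplex (thickening K) (d + 1), t.1 = insert (lo v) s.1 :=
    ⟨⟨_, htface⟩, rfl⟩
  have hb := chain_eq_sum_ket (boundary (thickening K) (d + 1) d (ket _ _ t.1))
  have hcoef : ∀ r : Simplex (thickening K) d,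
      coef (boundary (thickening K) (d + 1) d (ket _ _ t.1)) r.1 = (incidence t.1 r.1 : ℂ) := by
    intro r
    rw [coef_val]
    have : boundary (thickening K) (d + 1) d (ket _ _ t.1) r =
      ∑ t' : Simplex (thickening K) (d + 1),
        (incidence t'.1 r.1 : ℂ) * if t'.1 = t.1 then 1 else 0 := rfl
    rw [this, Finset.sum_eq_single t]
    · simp
    · intro b _ hb
      rw [if_neg fun h => hb (Subtype.ext h), mul_zero]
    · simp
  simp_rw [hcoef] at hb
  rw [← Finset.add_sum_erase _ _ (Finset.mem_univ s)] at hb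
  have hs1 : (incidence t.1 s.1 : ℂ) ≠ 0 := by
    rw [ht, incidence_insert hv0]
    exact_mod_cast posSign_ne_zero s.1 (lo v)
  rw [← sub_eq_iff_eq_add] at hb
  rw [← Submodule.smul_mem_iff _ hs1, ← hb]
  refine Submodule.sub_mem _ (Submodule.mem_sup_right ⟨_, rfl⟩) (Submodule.sum_mem _ ?_)
  intro r hr
  by_cases h0 : incidence t.1 r.1 = 0
  · simp [h0]
  refine Submodule.smul_mem _ _ ?_
  obtain ⟨a, ha, hra⟩ := exists_erase_of_incidence_ne_zero h0
  have hav : a ≠ lo v := by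
    rintro rfl
    rw [ht, Finset.erase_insert hv0] at hra
    exact (Finset.mem_erase.1 hr).1 (Subtype.ext hra)
  by_cases hah : a = hi v
  · refine ih ((slice 1 r.1).card) (lt_of_lt_of_le ?_ hsm) r le_rfl
    rw [hra, hah, slice_one_erase_hi, ht, slice_one_insert_lo]
    exact Finset.card_erase_lt_of_mem (by simpa using hv)
  · refine upper r ?_
    rintro ⟨w, hw, hw0, hwmin⟩
    rw [hra, ht] at hw hw0 hwmin
    have h1 : w ≤ v := hwmin v (by simp [hv, Ne.symm hah])
    have h2 : v ≤ w := hmin w (by simp at hw; exact hw.2)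
    obtain rfl := le_antisymm h1 h2
    exact hw0 (by simp [Ne.symm hav])

/-- A cycle that vanishes on the lower simplices vanishes on all simplices with a primed vertex:
its coefficient at such a simplex `s` with doubled least primed vertex `v` is determined by its
boundary at `s.erase (lo v)`, as the other cofaces of this face are lower or have fewer unprimed
vertices than `s`. -/
theorem coef_eq_zero_of_mem_upperChains {K : AbstractSimplicialComplex V} {d e : ℤ}
    (hde : d = e + 1) {ψ : Chain (thickening K) d} (hψ : ψ ∈ upperChains K d)
    (h0 : boundary (thickening K) d e ψ = 0) (m : ℕ) :
    ∀ s : Finset (V ×ₗ Fin 2), (slice 0 s).card ≤ m → (slice 1 s).Nonempty → coef ψ s = 0 := by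
  induction m using Nat.strong_induction_on with
  | _ m ih =>
  intro s hsm hs
  have hv := Finset.min'_mem _ hs
  have hmin : ∀ w, hi w ∈ s → (slice 1 s).min' hs ≤ w :=
    fun w hw => Finset.min'_le _ _ (mem_slice_one.2 hw)
  generalize (slice 1 s).min' hs = v at hv hmin
  rw [mem_slice_one] at hv
  by_cases hl : lo v ∈ s
  swap
  · exact mem_upperChains.1 hψ s ⟨v, hv, hl, hmin⟩
  have hb := coef_boundary hde ψ (s.erase (lo v))
  rw [h0, coef_zero, Finset.sum_eq_single (lo v), Finset.insert_erase hl] at hb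
  · exact (mul_eq_zero.1 hb.symm).resolve_left
      (by exact_mod_cast posSign_ne_zero _ _)
  · intro a ha hav
    refine mul_eq_zero_of_right _ ?_
    obtain ⟨u, rfl | rfl⟩ := lo_or_hi a
    · refine mem_upperChains.1 hψ _ ⟨v, by simp [hv], ?_, ?_⟩
      · simp [Ne.symm hav]
      · intro w hw
        simp at hw
        exact hmin w hw
    · refine ih _ (lt_of_lt_of_le ?_ hsm) _ le_rfl ⟨v, by simp [hv]⟩
      rw [slice_zero_insert_hi, slice_zero_erase_lo]
      exact Finset.card_erase_lt_of_mem (by simpa using hl)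
  · intro h
    simp at h

/-- Every cycle of a thickening is homologous to a cycle of the unprimed copy. -/
theorem exists_unprimed_cycle {K : AbstractSimplicialComplex V} {d e : ℤ} (hde : d = e + 1)
    {ψ : Chain (thickening K) d} (h0 : boundary (thickening K) d e ψ = 0) :
    ∃ w : Chain (thickening K) d, boundary (thickening K) d e w = 0 ∧
      (∀ s, (slice 1 s).Nonempty → coef w s = 0) ∧
      ψ - w ∈ LinearMap.range (boundary (thickening K) (d + 1) d) := by
  have hψ : ψ ∈ upperChains K d ⊔ LinearMap.range (boundary (thickening K) (d + 1) d) := by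
    rw [chain_eq_sum_ket ψ]
    exact Submodule.sum_mem _ fun s _ =>
      Submodule.smul_mem _ _ (ket_mem_upperChains_sup_range _ s le_rfl)
  obtain ⟨w, hw, b, hb, rfl⟩ := Submodule.mem_sup.1 hψ
  have hw0 : boundary (thickening K) d e w = 0 := by
    obtain ⟨c, rfl⟩ := hb
    rwa [map_add, boundary_boundary rfl hde, add_zero] at h0
  exact ⟨w, hw0, fun s hs => coef_eq_zero_of_mem_upperChains hde hw hw0 _ s le_rfl hs,
    by simpa using hb⟩

end Thickening

/-! ### Cells of the glued complex -/

section Order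

variable {V : Type*} [LinearOrder V] {u v : V}

@[simp] theorem lo_lt_lo : lo u < lo v ↔ u < v := by simp [lo, Prod.Lex.toLex_lt_toLex]

@[simp] theorem lo_lt_hi : lo u < hi v ↔ u ≤ v := by
  simp [lo, hi, Prod.Lex.toLex_lt_toLex, le_iff_lt_or_eq]

@[simp] theorem hi_lt_lo : hi u < lo v ↔ u < v := by simp [lo, hi, Prod.Lex.toLex_lt_toLex]

@[simp] theorem hi_lt_hi : hi u < hi v ↔ u < v := by simp [hi, Prod.Lex.toLex_lt_toLex]

end Order

section Cells

variable {n : ℕ}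

/-- The simplices of the glued complex, the empty one included, in terms of their vertices. -/
def IsCell (s : Finset (Fin (2 * n) ×ₗ Fin 2)) : Prop :=
  (∀ u, lo u ∈ s → ∀ v, hi v ∈ s → u ≤ v) ∧
    ∀ v ∈ support s, ∀ w ∈ support s, (v : ℕ) / 2 = (w : ℕ) / 2 → v = w

theorem mem_glued_or_empty {s : Finset (Fin (2 * n) ×ₗ Fin 2)} :
    (s ∈ glued n ∨ s = ∅) ↔ IsCell s := by
  have h1 : support s ∈ octahedron n ↔ (support s).Nonempty ∧
    ∀ v ∈ support s, ∀ w ∈ support s, (v : ℕ) / 2 = (w : ℕ) / 2 → v = w := Iff.rfl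
  rw [mem_thickening_or_empty, IsCell, h1]
  refine and_congr_right fun _ => ?_
  constructor
  · rintro (h | h)
    · exact h.2
    · simp [h]
  · intro h
    rcases (support s).eq_empty_or_nonempty with h0 | h0
    · exact Or.inr h0
    · exact Or.inl ⟨h0, h⟩

theorem isCell_of_mem {s : Finset (Fin (2 * n) ×ₗ Fin 2)} (h : s ∈ glued n) : IsCell s :=
  mem_glued_or_empty.1 (Or.inl h)

theorem IsCell.subset {s t : Finset (Fin (2 * n) ×ₗ Fin 2)} (ht : IsCell t) (h : s ⊆ t) :
    IsCell s := by
  have hs : ∀ v ∈ support s, v ∈ support t := by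
    intro v hv
    rw [mem_support] at hv ⊢
    exact hv.imp (fun h' => h h') (fun h' => h h')
  exact ⟨fun u hu v hv => ht.1 u (h hu) v (h hv),
    fun v hv w hw => ht.2 v (hs v hv) w (hs w hw)⟩

/-- The pair to which a vertex belongs. -/
def pair (v : Fin (2 * n)) : Fin n := ⟨v / 2, by omega⟩

theorem IsCell.injOn_pair {s : Finset (Fin (2 * n) ×ₗ Fin 2)} (hs : IsCell s) :
    Set.InjOn pair (support s : Set (Fin (2 * n))) :=
  fun v hv w hw h => hs.2 v hv w hw (by simpa [pair] using h)

theorem IsCell.card_support_le {s : Finset (Fin (2 * n) ×ₗ Fin 2)} (hs : IsCell s) :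
    (support s).card ≤ n := by
  rw [← Finset.card_image_of_injOn hs.injOn_pair]
  exact (Finset.card_le_univ _).trans (by simp)

theorem card_eq_support_add_inter (s : Finset (Fin (2 * n) ×ₗ Fin 2)) :
    s.card = (support s).card + (slice 0 s ∩ slice 1 s).card := by
  rw [card_slice_add, support, Finset.card_union_add_card_inter]

theorem IsCell.doubled_unique {s : Finset (Fin (2 * n) ×ₗ Fin 2)} (hs : IsCell s)
    {v w : Fin (2 * n)} (hv0 : lo v ∈ s) (hv1 : hi v ∈ s) (hw0 : lo w ∈ s) (hw1 : hi w ∈ s) :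
    v = w :=
  le_antisymm (hs.1 v hv0 w hw1) (hs.1 w hw0 v hv1)

theorem IsCell.card_inter_le_one {s : Finset (Fin (2 * n) ×ₗ Fin 2)} (hs : IsCell s) :
    (slice 0 s ∩ slice 1 s).card ≤ 1 := by
  rw [Finset.card_le_one]
  intro v hv w hw
  simp only [Finset.mem_inter, mem_slice_zero, mem_slice_one] at hv hw
  exact hs.doubled_unique hv.1 hv.2 hw.1 hw.2

theorem IsCell.card_support_of_top {t : Finset (Fin (2 * n) ×ₗ Fin 2)} (ht : IsCell t)
    (hc : t.card = n + 1) : (support t).card = n := by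
  have h1 := ht.card_support_le
  have h2 := ht.card_inter_le_one
  have h3 := card_eq_support_add_inter t
  omega

theorem IsCell.exists_doubled {t : Finset (Fin (2 * n) ×ₗ Fin 2)} (ht : IsCell t)
    (hc : t.card = n + 1) : ∃ v, lo v ∈ t ∧ hi v ∈ t := by
  have h1 := ht.card_support_le
  have h3 := card_eq_support_add_inter t
  obtain ⟨v, hv⟩ := Finset.card_pos.1 (show 0 < (slice 0 t ∩ slice 1 t).card by omega)
  simp only [Finset.mem_inter, mem_slice_zero, mem_slice_one] at hv
  exact ⟨v, hv⟩

/-- The doubled vertex is the last unprimed one: all unprimed vertices, and no others, precede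
its primed copy. -/
theorem IsCell.posSign_hi {t : Finset (Fin (2 * n) ×ₗ Fin 2)} (ht : IsCell t)
    {v : Fin (2 * n)} (h0 : lo v ∈ t) (h1 : hi v ∈ t) :
    posSign t (hi v) = (-1) ^ (slice 0 t).card := by
  have h : t.filter (· < hi v) = (slice 0 t).image lo := by
    ext a
    obtain ⟨w, rfl | rfl⟩ := lo_or_hi a
    · simpa using fun h => ht.1 w h v h1
    · simpa using fun h => ht.1 v h0 w h
  rw [posSign, h, Finset.card_image_of_injective _ fun _ _ => lo_inj.1]

theorem IsCell.posSign_lo {t : Finset (Fin (2 * n) ×ₗ Fin 2)} (ht : IsCell t)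
    {v : Fin (2 * n)} (h0 : lo v ∈ t) (h1 : hi v ∈ t) :
    posSign t (lo v) = -(-1) ^ (slice 0 t).card := by
  have h : t.filter (· < lo v) = ((slice 0 t).erase v).image lo := by
    ext a
    obtain ⟨w, rfl | rfl⟩ := lo_or_hi a
    · simp only [Finset.mem_filter, lo_lt_lo, Finset.mem_image, lo_inj, exists_eq_right,
        Finset.mem_erase, mem_slice_zero]
      constructor
      · exact fun h => ⟨h.2.ne, h.1⟩
      · exact fun h => ⟨h.2, lt_of_le_of_ne (ht.1 w h.2 v h1) h.1⟩
    · simpa using fun h => ht.1 v h0 w h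
  have hv : v ∈ slice 0 t := mem_slice_zero.2 h0
  rw [posSign, h, Finset.card_image_of_injective _ fun _ _ => lo_inj.1,
    ← Finset.card_erase_add_one hv, pow_succ]
  ring

/-- The simplices with one vertex over each pair: the members of the layers `hatLayer n k`. -/
def IsHat (s : Finset (Fin (2 * n) ×ₗ Fin 2)) : Prop :=
  IsCell s ∧ s.card = n ∧ ∀ v, lo v ∈ s → hi v ∉ s

theorem IsHat.card_support {s : Finset (Fin (2 * n) ×ₗ Fin 2)} (hs : IsHat s) :
    (support s).card = n := by
  have h3 := card_eq_support_add_inter s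
  have : slice 0 s ∩ slice 1 s = ∅ := by
    ext v
    simpa using hs.2.2 v
  rw [this, Finset.card_empty, hs.2.1] at h3
  exact h3.symm

theorem support_erase_lo {t : Finset (Fin (2 * n) ×ₗ Fin 2)} {v : Fin (2 * n)}
    (h1 : hi v ∈ t) : support (t.erase (lo v)) = support t := by
  ext w
  by_cases h : w = v
  · subst h
    simp [mem_support, h1]
  · simp [mem_support, h]

theorem support_erase_hi {t : Finset (Fin (2 * n) ×ₗ Fin 2)} {v : Fin (2 * n)}
    (h0 : lo v ∈ t) : support (t.erase (hi v)) = support t := by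
  ext w
  by_cases h : w = v
  · subst h
    simp [mem_support, h0]
  · simp [mem_support, h]

theorem IsCell.isHat_erase_lo {t : Finset (Fin (2 * n) ×ₗ Fin 2)} (ht : IsCell t)
    (hc : t.card = n + 1) {v : Fin (2 * n)} (h0 : lo v ∈ t) (h1 : hi v ∈ t) :
    IsHat (t.erase (lo v)) := by
  refine ⟨ht.subset (Finset.erase_subset _ _), by rw [Finset.card_erase_of_mem h0, hc]; rfl, ?_⟩
  intro w hw hw1
  have := ht.doubled_unique h0 h1 (Finset.mem_of_mem_erase hw) (Finset.mem_of_mem_erase hw1)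
  subst this
  simp at hw

theorem IsCell.isHat_erase_hi {t : Finset (Fin (2 * n) ×ₗ Fin 2)} (ht : IsCell t)
    (hc : t.card = n + 1) {v : Fin (2 * n)} (h0 : lo v ∈ t) (h1 : hi v ∈ t) :
    IsHat (t.erase (hi v)) := by
  refine ⟨ht.subset (Finset.erase_subset _ _), by rw [Finset.card_erase_of_mem h1, hc]; rfl, ?_⟩
  intro w hw hw1
  have := ht.doubled_unique h0 h1 (Finset.mem_of_mem_erase hw) (Finset.mem_of_mem_erase hw1)
  subst this
  simp at hw1

/-- The only faces of an `n`-simplex with one vertex over each pair are those obtained by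
removing a copy of the doubled vertex. -/
theorem eq_of_isHat_erase {t : Finset (Fin (2 * n) ×ₗ Fin 2)} {v : Fin (2 * n)}
    (h0 : lo v ∈ t) (h1 : hi v ∈ t) {a : Fin (2 * n) ×ₗ Fin 2} (h : IsHat (t.erase a)) :
    a = lo v ∨ a = hi v := by
  by_contra hcon
  rw [not_or] at hcon
  exact h.2.2 v (Finset.mem_erase.2 ⟨Ne.symm hcon.1, h0⟩) (Finset.mem_erase.2 ⟨Ne.symm hcon.2, h1⟩)

theorem IsHat.eq_erase {s t : Finset (Fin (2 * n) ×ₗ Fin 2)} (hs : IsHat s)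
    (hc : t.card = n + 1) (hst : s ⊆ t) {v : Fin (2 * n)} (h0 : lo v ∈ t) (h1 : hi v ∈ t) :
    s = t.erase (lo v) ∨ s = t.erase (hi v) := by
  obtain ⟨a, ha, has⟩ : ∃ a ∈ t, s = t.erase a := by
    have h2 : (t \ s).card = 1 := by
      rw [Finset.card_sdiff_of_subset hst, hc, hs.2.1]
      omega
    obtain ⟨a, ha⟩ := Finset.card_eq_one.1 h2
    have hat : a ∈ t \ s := by simp [ha]
    refine ⟨a, (Finset.mem_sdiff.1 hat).1, ?_⟩
    rw [← Finset.sdiff_singleton_eq_erase, ← ha, Finset.sdiff_sdiff_eq_self hst]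
  rw [has] at hs ⊢
  rcases eq_of_isHat_erase h0 h1 hs with rfl | rfl
  · exact Or.inl rfl
  · exact Or.inr rfl

/-- Doubling the least primed vertex of a simplex with one vertex over each pair. -/
theorem IsHat.insert_lo {s : Finset (Fin (2 * n) ×ₗ Fin 2)} (hs : IsHat s) {v : Fin (2 * n)}
    (h1 : hi v ∈ s) (hmin : ∀ w, hi w ∈ s → v ≤ w) :
    lo v ∉ s ∧ IsCell (insert (lo v) s) ∧ (insert (lo v) s).card = n + 1 := by
  have h0 : lo v ∉ s := fun h => hs.2.2 v h h1
  refine ⟨h0, ⟨?_, ?_⟩, by rw [Finset.card_insert_of_notMem h0, hs.2.1]⟩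
  · intro u hu w hw
    simp only [Finset.mem_insert, lo_inj, hi_ne_lo, false_or] at hu hw
    rcases hu with rfl | hu
    · exact hmin w hw
    · exact hs.1.1 u hu w hw
  · have := support_erase_lo (t := insert (lo v) s) (v := v) (by simp [h1])
    rw [Finset.erase_insert h0] at this
    rw [← this]
    exact hs.1.2

/-- Doubling the greatest unprimed vertex of a simplex with one vertex over each pair. -/
theorem IsHat.insert_hi {s : Finset (Fin (2 * n) ×ₗ Fin 2)} (hs : IsHat s) {v : Fin (2 * n)}
    (h0 : lo v ∈ s) (hmax : ∀ w, lo w ∈ s → w ≤ v) :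
    hi v ∉ s ∧ IsCell (insert (hi v) s) ∧ (insert (hi v) s).card = n + 1 := by
  have h1 : hi v ∉ s := hs.2.2 v h0
  refine ⟨h1, ⟨?_, ?_⟩, by rw [Finset.card_insert_of_notMem h1, hs.2.1]⟩
  · intro u hu w hw
    simp only [Finset.mem_insert, hi_inj, lo_ne_hi, false_or] at hu hw
    rcases hw with rfl | hw
    · exact hmax u hu
    · exact hs.1.1 u hu w hw
  · have := support_erase_hi (t := insert (hi v) s) (v := v) (by simp [h0])
    rw [Finset.erase_insert h1] at this
    rw [← this]
    exact hs.1.2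

/-! ### The layers in terms of vertices -/

theorem pair_vertex (i : Fin n) (b : Fin 2) : pair (vertex i b) = i := by
  ext
  simp only [pair, vertex]
  omega

theorem vertex_injective (x : Fin n → Fin 2) : Function.Injective fun i => vertex i (x i) :=
  fun i j h => by simpa [pair_vertex] using congrArg pair h

theorem eq_vertex_pair (v : Fin (2 * n)) : ∃ b, v = vertex (pair v) b :=
  ⟨⟨v % 2, by omega⟩, by ext; simp only [pair, vertex]; omega⟩

/-- A set of vertices that over a choice `x` of one vertex in each pair has the first `a` ones
unprimed and those from the `b`-th on primed, where `b = a` or `b = a - 1`. -/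
theorem isCell_of_threshold {s : Finset (Fin (2 * n) ×ₗ Fin 2)} (x : Fin n → Fin 2) {a b : ℕ}
    (han : a ≤ n) (hbn : b ≤ n) (hab : a ≤ b + 1)
    (h0 : ∀ u, lo u ∈ s ↔ ∃ i : Fin n, (i : ℕ) < a ∧ vertex i (x i) = u)
    (h1 : ∀ u, hi u ∈ s ↔ ∃ i : Fin n, b ≤ (i : ℕ) ∧ vertex i (x i) = u) :
    IsCell s ∧ (slice 0 s).card = a ∧ (slice 1 s).card = n - b := by
  refine ⟨⟨?_, ?_⟩, ?_, ?_⟩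
  · intro u hu v hv
    obtain ⟨i, hi, rfl⟩ := (h0 u).1 hu
    obtain ⟨j, hj, rfl⟩ := (h1 v).1 hv
    rcases eq_or_ne i j with rfl | hij
    · exact le_rfl
    · have : (i : ℕ) ≠ j := fun h => hij (Fin.ext h)
      rw [Fin.le_def]
      simp only [vertex]
      omega
  · have hx : ∀ v ∈ support s, ∃ i : Fin n, vertex i (x i) = v := by
      intro v hv
      rw [mem_support, h0, h1] at hv
      rcases hv with ⟨i, -, hi⟩ | ⟨i, -, hi⟩
      · exact ⟨i, hi⟩
      · exact ⟨i, hi⟩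
    intro v hv w hw h
    obtain ⟨i, rfl⟩ := hx v hv
    obtain ⟨j, rfl⟩ := hx w hw
    have : pair (vertex i (x i)) = pair (vertex j (x j)) := Fin.ext h
    rw [pair_vertex, pair_vertex] at this
    rw [this]
  · have : slice 0 s = (Finset.univ.filter fun i : Fin n => (i : ℕ) < a).image
        fun i => vertex i (x i) := by
      ext u
      simp [h0]
    rw [this, Finset.card_image_of_injective _ (vertex_injective x), Fin.card_filter_val_lt]
    omega
  · have : slice 1 s = (Finset.univ.filter fun i : Fin n => ¬ (i : ℕ) < b).image
        fun i => vertex i (x i) := by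
      ext u
      simp [h1]
    have h2 := Finset.card_filter_add_card_filter_not (s := (Finset.univ : Finset (Fin n)))
      fun i : Fin n => (i : ℕ) < b
    rw [Finset.card_univ, Fintype.card_fin, Fin.card_filter_val_lt] at h2
    rw [this, Finset.card_image_of_injective _ (vertex_injective x)]
    omega

/-- A cell over `n` vertices of the octahedron lies over a maximal simplex, that is, over a choice
of one vertex in each pair. -/
theorem IsCell.exists_choice {s : Finset (Fin (2 * n) ×ₗ Fin 2)} (hs : IsCell s)
    (hc : (support s).card = n) :
    ∃ x : Fin n → Fin 2, ∀ u, u ∈ support s ↔ ∃ i, vertex i (x i) = u := by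
  have himg : (support s).image pair = Finset.univ := by
    rw [← Finset.card_eq_iff_eq_univ, Finset.card_image_of_injOn hs.injOn_pair, hc,
      Fintype.card_fin]
  have hx : ∀ i : Fin n, ∃ b, vertex i b ∈ support s := by
    intro i
    obtain ⟨v, hv, rfl⟩ := Finset.mem_image.1 (himg ▸ Finset.mem_univ i)
    obtain ⟨b, hb⟩ := eq_vertex_pair v
    exact ⟨b, hb ▸ hv⟩
  choose x hx using hx
  refine ⟨x, fun u => ⟨fun hu => ⟨pair u, ?_⟩, ?_⟩⟩
  · exact hs.injOn_pair (hx _) hu (pair_vertex _ _)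
  · rintro ⟨i, rfl⟩
    exact hx i

theorem lo_mem_hat_image (x : Fin n → Fin 2) (k : ℕ) (u : Fin (2 * n)) :
    lo u ∈ (Finset.univ.image fun i : Fin n =>
      (toLex (vertex i (x i), if (i : ℕ) + k < n then 0 else 1) : Fin (2 * n) ×ₗ Fin 2)) ↔
    ∃ i : Fin n, (i : ℕ) < n - k ∧ vertex i (x i) = u := by
  simp only [lo, Finset.mem_image, Finset.mem_univ, true_and, EmbeddingLike.apply_eq_iff_eq,
    Prod.mk.injEq]
  refine exists_congr fun i => ?_
  by_cases h : (i : ℕ) + k < n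
  · simp [h, show (i : ℕ) < n - k by omega]
  · simp [h, show ¬ (i : ℕ) < n - k by omega]

theorem hi_mem_hat_image (x : Fin n → Fin 2) (k : ℕ) (u : Fin (2 * n)) :
    hi u ∈ (Finset.univ.image fun i : Fin n =>
      (toLex (vertex i (x i), if (i : ℕ) + k < n then 0 else 1) : Fin (2 * n) ×ₗ Fin 2)) ↔
    ∃ i : Fin n, n - k ≤ (i : ℕ) ∧ vertex i (x i) = u := by
  simp only [hi, Finset.mem_image, Finset.mem_univ, true_and, EmbeddingLike.apply_eq_iff_eq,
    Prod.mk.injEq]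
  refine exists_congr fun i => ?_
  by_cases h : (i : ℕ) + k < n
  · simp [h, show ¬ n - k ≤ (i : ℕ) by omega]
  · simp [h, show n - k ≤ (i : ℕ) by omega]

theorem eq_of_lo_hi {s t : Finset (Fin (2 * n) ×ₗ Fin 2)} (h0 : ∀ u, lo u ∈ s ↔ lo u ∈ t)
    (h1 : ∀ u, hi u ∈ s ↔ hi u ∈ t) : s = t := by
  ext a
  obtain ⟨u, rfl | rfl⟩ := lo_or_hi a
  · exact h0 u
  · exact h1 u

/-- The layer `hatLayer n k` consists of the simplices with one vertex over each pair and `k`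
primed vertices. -/
theorem mem_hatLayer {k : ℕ} (hk : k ≤ n) {s : Finset (Fin (2 * n) ×ₗ Fin 2)} :
    s ∈ hatLayer n k ↔ IsHat s ∧ (slice 1 s).card = k := by
  constructor
  · intro h
    obtain ⟨x, -, rfl⟩ := Finset.mem_image.1 h
    obtain ⟨h1, h2, h3⟩ := isCell_of_threshold x (Nat.sub_le n k) (Nat.sub_le n k) (by omega)
      (lo_mem_hat_image x k) (hi_mem_hat_image x k)
    refine ⟨⟨h1, ?_, ?_⟩, by omega⟩
    · rw [card_slice_add]
      omega
    · intro v h0 h1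
      obtain ⟨i, hi, rfl⟩ := (lo_mem_hat_image x k v).1 h0
      obtain ⟨j, hj, hij⟩ := (hi_mem_hat_image x k _).1 h1
      have := vertex_injective x hij
      subst this
      omega
  · rintro ⟨hs, hsk⟩
    obtain ⟨x, hx⟩ := hs.1.exists_choice hs.card_support
    refine Finset.mem_image.2 ⟨x, Finset.mem_univ _, ?_⟩
    -- The pairs with an unprimed vertex form a lower set of size `n - k`.
    have hA : ∀ i, lo (vertex i (x i)) ∈ s ↔ (i : ℕ) < n - k := by
      have hcard : (Finset.univ.filter fun i => lo (vertex i (x i)) ∈ s).card = n - k := by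
        have : slice 0 s = (Finset.univ.filter fun i => lo (vertex i (x i)) ∈ s).image
            fun i => vertex i (x i) := by
          ext u
          simp only [mem_slice_zero, Finset.mem_image, Finset.mem_filter, Finset.mem_univ,
            true_and]
          constructor
          · intro hu
            obtain ⟨i, rfl⟩ := (hx u).1 (mem_support.2 (Or.inl hu))
            exact ⟨i, hu, rfl⟩
          · rintro ⟨i, hi, rfl⟩
            exact hi
        have h2 := card_slice_add s
        rw [this, Finset.card_image_of_injective _ (vertex_injective x), hs.2.1] at h2
        omega
      have hlower : ∀ i j : Fin n, lo (vertex i (x i)) ∈ s → j ≤ i → lo (vertex j (x j)) ∈ s := by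
        intro i j hi hj
        rcases mem_support.1 ((hx _).2 ⟨j, rfl⟩) with h | h
        · exact h
        · have h2 := hs.1.1 _ hi _ h
          rw [Fin.le_def] at h2 hj
          simp only [vertex] at h2
          have : i = j := Fin.ext (by omega)
          rwa [this] at hi
      intro i
      rw [← hcard]
      constructor
      · intro hi
        have : Finset.Iic i ⊆ Finset.univ.filter fun i => lo (vertex i (x i)) ∈ s := by
          intro j hj
          simpa using hlower i j hi (Finset.mem_Iic.1 hj)
        have := Finset.card_le_card this
        rw [Fin.card_Iic] at this
        omega
      · intro hi
        by_contra hcon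
        have : (Finset.univ.filter fun i => lo (vertex i (x i)) ∈ s) ⊆ Finset.Iio i := by
          intro j hj
          rw [Finset.mem_filter] at hj
          rw [Finset.mem_Iio]
          by_contra hji
          exact hcon (hlower j i hj.2 (not_lt.1 hji))
        have := Finset.card_le_card this
        rw [Fin.card_Iio] at this
        omega
    refine eq_of_lo_hi (fun u => ?_) (fun u => ?_)
    · rw [lo_mem_hat_image]
      constructor
      · rintro ⟨i, hi, rfl⟩
        exact (hA i).2 hi
      · intro hu
        obtain ⟨i, rfl⟩ := (hx u).1 (mem_support.2 (Or.inl hu))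
        exact ⟨i, (hA i).1 hu, rfl⟩
    · rw [hi_mem_hat_image]
      constructor
      · rintro ⟨i, hi, rfl⟩
        exact (mem_support.1 ((hx _).2 ⟨i, rfl⟩)).resolve_left
          fun h => by have := (hA i).1 h; omega
      · intro hu
        obtain ⟨i, rfl⟩ := (hx u).1 (mem_support.2 (Or.inr hu))
        refine ⟨i, ?_, rfl⟩
        by_contra hcon
        exact hs.2.2 _ ((hA i).2 (by omega)) hu

theorem lo_mem_layer_image (x : Fin n → Fin 2) (k : ℕ) (hk : k < n) (u : Fin (2 * n)) :
    lo u ∈ ((Finset.univ.filter fun i : Fin n => (i : ℕ) + (k + 1) ≤ n).image fun i =>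
        (toLex (vertex i (x i), 0) : Fin (2 * n) ×ₗ Fin 2)) ∪
      ((Finset.univ.filter fun i : Fin n => n ≤ (i : ℕ) + (k + 1)).image fun i =>
        (toLex (vertex i (x i), 1) : Fin (2 * n) ×ₗ Fin 2)) ↔
    ∃ i : Fin n, (i : ℕ) < n - k ∧ vertex i (x i) = u := by
  simp only [lo, Finset.mem_union, Finset.mem_image, Finset.mem_filter, Finset.mem_univ, true_and,
    EmbeddingLike.apply_eq_iff_eq, Prod.mk.injEq, one_ne_zero, and_false, exists_false, or_false,
    and_true]
  refine exists_congr fun i => and_congr_left fun _ => ?_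
  omega

theorem hi_mem_layer_image (x : Fin n → Fin 2) (k : ℕ) (hk : k < n) (u : Fin (2 * n)) :
    hi u ∈ ((Finset.univ.filter fun i : Fin n => (i : ℕ) + (k + 1) ≤ n).image fun i =>
        (toLex (vertex i (x i), 0) : Fin (2 * n) ×ₗ Fin 2)) ∪
      ((Finset.univ.filter fun i : Fin n => n ≤ (i : ℕ) + (k + 1)).image fun i =>
        (toLex (vertex i (x i), 1) : Fin (2 * n) ×ₗ Fin 2)) ↔
    ∃ i : Fin n, n - k - 1 ≤ (i : ℕ) ∧ vertex i (x i) = u := by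
  simp only [hi, Finset.mem_union, Finset.mem_image, Finset.mem_filter, Finset.mem_univ, true_and,
    EmbeddingLike.apply_eq_iff_eq, Prod.mk.injEq, zero_ne_one, and_false, exists_false, false_or,
    and_true]
  refine exists_congr fun i => and_congr_left fun _ => ?_
  omega

/-- The layer `layer n (k + 1)` consists of the `n`-simplices with `k + 1` primed vertices. -/
theorem mem_layer {k : ℕ} (hk : k < n) {t : Finset (Fin (2 * n) ×ₗ Fin 2)} :
    t ∈ layer n (k + 1) ↔ IsCell t ∧ t.card = n + 1 ∧ (slice 1 t).card = k + 1 := by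
  have key : ∀ k < n, ∀ t ∈ layer n (k + 1),
      IsCell t ∧ t.card = n + 1 ∧ (slice 1 t).card = k + 1 := by
    intro k hk t h
    obtain ⟨x, -, rfl⟩ := Finset.mem_image.1 h
    obtain ⟨h1, h2, h3⟩ := isCell_of_threshold x (Nat.sub_le n k)
      (show n - k - 1 ≤ n by omega) (by omega)
      (lo_mem_layer_image x k hk) (hi_mem_layer_image x k hk)
    refine ⟨h1, ?_, by omega⟩
    rw [card_slice_add]
    omega
  refine ⟨key k hk t, ?_⟩
  rintro ⟨ht, hc, htk⟩
  obtain ⟨x, hx⟩ := ht.exists_choice (ht.card_support_of_top hc)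
  obtain ⟨v, h0, h1⟩ := ht.exists_doubled hc
  obtain ⟨j, rfl⟩ := (hx v).1 (mem_support.2 (Or.inl h0))
  have hmem : t ∈ layer n ((n - j - 1) + 1) := by
    refine Finset.mem_image.2 ⟨x, Finset.mem_univ _, ?_⟩
    -- Comparison with the two copies of the vertex over the pair `j` shows that the earlier
    -- vertices are unprimed and the later ones primed.
    refine eq_of_lo_hi (fun u => ?_) (fun u => ?_)
    · rw [lo_mem_layer_image x _ (by omega)]
      constructor
      · rintro ⟨i, hi, rfl⟩
        rcases mem_support.1 ((hx _).2 ⟨i, rfl⟩) with h | h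
        · exact h
        · have h2 := ht.1 _ h0 _ h
          rw [Fin.le_def] at h2
          simp only [vertex] at h2
          have : i = j := Fin.ext (by omega)
          rwa [this]
      · intro hu
        obtain ⟨i, rfl⟩ := (hx u).1 (mem_support.2 (Or.inl hu))
        have h2 := ht.1 _ hu _ h1
        rw [Fin.le_def] at h2
        simp only [vertex] at h2
        exact ⟨i, by omega, rfl⟩
    · rw [hi_mem_layer_image x _ (by omega)]
      constructor
      · rintro ⟨i, hi, rfl⟩
        rcases mem_support.1 ((hx _).2 ⟨i, rfl⟩) with h | h
        · have h2 := ht.1 _ h _ h1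
          rw [Fin.le_def] at h2
          simp only [vertex] at h2
          have : i = j := Fin.ext (by omega)
          rwa [this]
        · exact h
      · intro hu
        obtain ⟨i, rfl⟩ := (hx u).1 (mem_support.2 (Or.inr hu))
        have h2 := ht.1 _ h0 _ hu
        rw [Fin.le_def] at h2
        simp only [vertex] at h2
        exact ⟨i, by omega, rfl⟩
  have := (key _ (by omega) t hmem).2.2
  rw [htk] at this
  rwa [← this] at hmem

end Cells

/-! ### The orientation -/

section Orientation

variable {n : ℕ}

/-- The orientation of the simplices with one vertex over each pair is that of their image in
the octahedron; an `n`-simplex with `c` unprimed vertices differs from its image by `(-1) ^ c`. -/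
def stdSign (s : Finset (Fin (2 * n) ×ₗ Fin 2)) : ℤˣ :=
  octaSign (support s) * if s.card = n then 1 else (-1) ^ (slice 0 s).card

theorem stdSign_hat {s : Finset (Fin (2 * n) ×ₗ Fin 2)} (hs : s.card = n) :
    stdSign s = octaSign (support s) := by
  simp [stdSign, hs]

theorem stdSign_top {t : Finset (Fin (2 * n) ×ₗ Fin 2)} (hc : t.card = n + 1) :
    stdSign t = octaSign (support t) * (-1) ^ (slice 0 t).card := by
  simp [stdSign, hc]

theorem card_slice_one_erase_hi {t : Finset (Fin (2 * n) ×ₗ Fin 2)} {v : Fin (2 * n)}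
    (h1 : hi v ∈ t) : (slice 1 (t.erase (hi v))).card + 1 = (slice 1 t).card := by
  rw [slice_one_erase_hi, Finset.card_erase_add_one (mem_slice_one.2 h1)]

theorem slice_copy_zero (s : Finset (Fin (2 * n))) :
    slice 0 (copy 0 s) = s ∧ slice 1 (copy 0 s) = ∅ := by
  constructor <;> ext u <;> simp [copy, slice]

theorem slice_copy_one (s : Finset (Fin (2 * n))) :
    slice 1 (copy 1 s) = s ∧ slice 0 (copy 1 s) = ∅ := by
  constructor <;> ext u <;> simp [copy, slice]

theorem eq_copy_zero {s : Finset (Fin (2 * n) ×ₗ Fin 2)} (h : slice 1 s = ∅) :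
    s = copy 0 (slice 0 s) := by
  refine eq_of_lo_hi (fun u => ?_) (fun u => ?_)
  · rw [← mem_slice_zero, ← mem_slice_zero, (slice_copy_zero _).1]
  · rw [← mem_slice_one, ← mem_slice_one, (slice_copy_zero _).2, h]

theorem eq_copy_one {s : Finset (Fin (2 * n) ×ₗ Fin 2)} (h : slice 0 s = ∅) :
    s = copy 1 (slice 1 s) := by
  refine eq_of_lo_hi (fun u => ?_) (fun u => ?_)
  · rw [← mem_slice_zero, ← mem_slice_zero, (slice_copy_one _).2, h]
  · rw [← mem_slice_one, ← mem_slice_one, (slice_copy_one _).1]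

theorem isLayerOrientation_stdSign (n : ℕ) : IsLayerOrientation n stdSign where
  base s _ hc := by
    have hc' : (copy 0 s).card = n := by
      rw [card_slice_add, (slice_copy_zero s).1, (slice_copy_zero s).2, hc]
      simp
    rw [stdSign_hat hc', support, (slice_copy_zero s).1, (slice_copy_zero s).2]
    simp
  opposite k hk s hs s' hs' t ht hc hst hst' := by
    have htc := isCell_of_mem ht
    obtain ⟨v, h0, h1⟩ := htc.exists_doubled hc
    obtain ⟨hs, hsk⟩ := (mem_hatLayer hk.le).1 hs
    obtain ⟨hs', hsk'⟩ := (mem_hatLayer hk).1 hs'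
    have h1e := card_slice_one_erase_hi h1
    rw [stdSign_hat hs.2.1, stdSign_hat hs'.2.1]
    rcases hs.eq_erase hc hst h0 h1 with rfl | rfl <;>
      rcases hs'.eq_erase hc hst' h0 h1 with rfl | rfl
    · rw [hsk] at hsk'
      omega
    · rw [slice_one_erase_lo] at hsk
      omega
    · rw [incidence_erase h1, incidence_erase h0, support_erase_lo h1, support_erase_hi h0,
        htc.posSign_lo h0 h1, htc.posSign_hi h0 h1]
      ring
    · rw [hsk] at hsk'
      omega
  induced k hk t ht s hs hst := by
    obtain ⟨htc, hc, htk⟩ := (mem_layer hk).1 ht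
    obtain ⟨v, h0, h1⟩ := htc.exists_doubled hc
    obtain ⟨hs, hsk⟩ := (mem_hatLayer hk.le).1 hs
    rw [stdSign_hat hs.2.1, stdSign_top hc]
    rcases hs.eq_erase hc hst h0 h1 with rfl | rfl
    · rw [slice_one_erase_lo] at hsk
      omega
    · rw [incidence_erase h1, htc.posSign_hi h0 h1, support_erase_hi h0]
      push_cast
      rfl

/-- The conditions determine the orientation of the simplices with one vertex over each pair:
doubling the least primed vertex connects a layer with the preceding one. -/
theorem IsLayerOrientation.eq_of_isHat {o : Finset (Fin (2 * n) ×ₗ Fin 2) → ℤˣ}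
    (ho : IsLayerOrientation n o) (hn : 1 ≤ n) (k : ℕ) :
    ∀ s, IsHat s → (slice 1 s).card = k → o s = octaSign (support s) := by
  induction k with
  | zero =>
    intro s hs hk
    rw [Finset.card_eq_zero] at hk
    have h2 : support s = slice 0 s := by rw [support, hk, Finset.union_empty]
    have hcard : (slice 0 s).card = n := by rw [← h2, hs.card_support]
    have := ho.base (slice 0 s) ⟨Finset.card_pos.1 (by omega), h2 ▸ hs.1.2⟩ hcard
    rwa [← eq_copy_zero hk, ← h2] at this
  | succ k ih =>
    intro s hs hk
    have hne : (slice 1 s).Nonempty := Finset.card_pos.1 (by omega)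
    have hv := Finset.min'_mem _ hne
    have hmin : ∀ w, hi w ∈ s → (slice 1 s).min' hne ≤ w :=
      fun w hw => Finset.min'_le _ _ (mem_slice_one.2 hw)
    generalize (slice 1 s).min' hne = v at hv hmin
    rw [mem_slice_one] at hv
    obtain ⟨hv0, ht, hc⟩ := hs.insert_lo hv hmin
    have hkn : k < n := by
      have := card_slice_add s
      have := hs.2.1
      omega
    have hst : s = (insert (lo v) s).erase (lo v) := (Finset.erase_insert hv0).symm
    have hslice : (slice 1 (insert (lo v) s)).card = k + 1 := by rw [slice_one_insert_lo, hk]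
    have h0 : lo v ∈ insert (lo v) s := Finset.mem_insert_self _ _
    have h1 : hi v ∈ insert (lo v) s := Finset.mem_insert_of_mem hv
    have hmem : insert (lo v) s ∈ glued n :=
      (mem_glued_or_empty.2 ht).resolve_right (Finset.insert_ne_empty _ _)
    have hsk : s ∈ hatLayer n (k + 1) := (mem_hatLayer hkn).2 ⟨hs, hk⟩
    generalize insert (lo v) s = t at *
    have hhat := ht.isHat_erase_hi hc h0 h1
    have h1e := card_slice_one_erase_hi h1
    have hopp := ho.opposite k hkn (t.erase (hi v))
      ((mem_hatLayer hkn.le).2 ⟨hhat, by omega⟩) s hsk t hmem hc (Finset.erase_subset _ _)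
      (hst ▸ Finset.erase_subset _ _)
    rw [ih _ hhat (by omega), support_erase_hi h0] at hopp
    rw [hst] at hopp ⊢
    rw [incidence_erase h1, incidence_erase h0, ht.posSign_lo h0 h1, ht.posSign_hi h0 h1] at hopp
    rw [support_erase_lo h1]
    have hpow : ((-1 : ℤ) ^ (slice 0 t).card) ≠ 0 := by simp
    refine Units.ext (mul_right_cancel₀ hpow ?_)
    linarith

/-- The face without the primed copy of the doubled vertex induces the orientation of an
`n`-simplex. -/
theorem IsLayerOrientation.eq_of_top {o : Finset (Fin (2 * n) ×ₗ Fin 2) → ℤˣ}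
    (ho : IsLayerOrientation n o) (hn : 1 ≤ n) {t : Finset (Fin (2 * n) ×ₗ Fin 2)}
    (ht : IsCell t) (hc : t.card = n + 1) :
    o t = octaSign (support t) * (-1) ^ (slice 0 t).card := by
  obtain ⟨v, h0, h1⟩ := ht.exists_doubled hc
  have hhat := ht.isHat_erase_hi hc h0 h1
  have h1e := card_slice_one_erase_hi h1
  have hle : (slice 1 (t.erase (hi v))).card < n := by
    have h2 := card_slice_add (t.erase (hi v))
    have h3 := Finset.card_pos.2 ⟨v, mem_slice_zero.2 h0⟩
    rw [slice_zero_erase_hi, hhat.2.1] at h2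
    omega
  have := ho.induced _ hle t ((mem_layer hle).2 ⟨ht, hc, by omega⟩) _
    ((mem_hatLayer hle.le).2 ⟨hhat, rfl⟩) (Finset.erase_subset _ _)
  rw [ho.eq_of_isHat hn _ _ hhat rfl, incidence_erase h1, ht.posSign_hi h0 h1,
    support_erase_hi h0] at this
  refine Units.ext ?_
  rw [this]
  push_cast
  rfl

end Orientation

/-! ### Exchanging the two vertices of a pair -/

section Flip

variable {n : ℕ}

/-- The other vertex of the same pair. -/
def flip (u : Fin (2 * n)) : Fin (2 * n) :=
  ⟨if (u : ℕ) % 2 = 0 then u + 1 else u - 1, by split_ifs <;> omega⟩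

theorem val_flip (u : Fin (2 * n)) :
    ((flip u : Fin (2 * n)) : ℕ) = if (u : ℕ) % 2 = 0 then (u : ℕ) + 1 else u - 1 := rfl

theorem flip_flip (u : Fin (2 * n)) : flip (flip u) = u := by
  ext
  rw [val_flip, val_flip]
  split_ifs <;> omega

theorem flip_ne (u : Fin (2 * n)) : flip u ≠ u := by
  intro h
  have := congrArg Fin.val h
  rw [val_flip] at this
  split_ifs at this <;> omega

theorem pair_flip (u : Fin (2 * n)) : pair (flip u) = pair u := by
  ext
  simp only [pair, val_flip]
  split_ifs <;> omega

theorem lt_flip_iff {u v : Fin (2 * n)} (h : pair u ≠ pair v) : u < flip v ↔ u < v := by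
  have h' : (u : ℕ) / 2 ≠ (v : ℕ) / 2 := fun h' => h (Fin.ext h')
  rw [Fin.lt_def, Fin.lt_def, val_flip]
  split_ifs <;> omega

theorem le_flip_iff {u v : Fin (2 * n)} (h : pair u ≠ pair v) : u ≤ flip v ↔ u ≤ v := by
  have h' : (u : ℕ) / 2 ≠ (v : ℕ) / 2 := fun h' => h (Fin.ext h')
  rw [Fin.le_def, Fin.le_def, val_flip]
  split_ifs <;> omega

theorem flip_le_iff {u v : Fin (2 * n)} (h : pair v ≠ pair u) : flip u ≤ v ↔ u ≤ v := by
  have h' : (v : ℕ) / 2 ≠ (u : ℕ) / 2 := fun h' => h (Fin.ext h')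
  rw [Fin.le_def, Fin.le_def, val_flip]
  split_ifs <;> omega

theorem octaSign_insert {r : Finset (Fin (2 * n))} {u : Fin (2 * n)} (hu : u ∉ r) :
    octaSign (insert u r) = (-1) ^ ((u : ℕ) + 1) * octaSign r := by
  rw [octaSign, octaSign, Finset.sum_insert hu, pow_add]

theorem octaSign_insert_flip {r : Finset (Fin (2 * n))} {u : Fin (2 * n)} (hu : u ∉ r)
    (hu' : flip u ∉ r) : octaSign (insert (flip u) r) = -octaSign (insert u r) := by
  rw [octaSign_insert hu, octaSign_insert hu', val_flip]
  split_ifs with h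
  · rw [pow_succ _ ((u : ℕ) + 1)]
    simp
  · have : (u : ℕ) = (u - 1) + 1 := by omega
    conv_rhs => rw [this, pow_succ _ ((u : ℕ) - 1 + 1)]
    simp

/-- The vertex of the octahedron below a vertex of the glued complex. -/
def base (a : Fin (2 * n) ×ₗ Fin 2) : Fin (2 * n) := (ofLex a).1

@[simp] theorem base_lo (u : Fin (2 * n)) : base (lo u) = u := rfl

@[simp] theorem base_hi (u : Fin (2 * n)) : base (hi u) = u := rfl

/-- Exchange of the two vertices of a pair, in both copies of the octahedron. -/
def flipVertex (a : Fin (2 * n) ×ₗ Fin 2) : Fin (2 * n) ×ₗ Fin 2 :=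
  toLex (flip (ofLex a).1, (ofLex a).2)

@[simp] theorem flipVertex_lo (u : Fin (2 * n)) : flipVertex (lo u) = lo (flip u) := rfl

@[simp] theorem flipVertex_hi (u : Fin (2 * n)) : flipVertex (hi u) = hi (flip u) := rfl

theorem flipVertex_flipVertex (a : Fin (2 * n) ×ₗ Fin 2) : flipVertex (flipVertex a) = a := by
  obtain ⟨u, rfl | rfl⟩ := lo_or_hi a <;> simp [flip_flip]

theorem base_flipVertex (a : Fin (2 * n) ×ₗ Fin 2) : base (flipVertex a) = flip (base a) := rfl

theorem flipVertex_ne (a : Fin (2 * n) ×ₗ Fin 2) : flipVertex a ≠ a :=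
  fun h => flip_ne _ (congrArg base h)

/-- No vertex of `s` lies over the pair of the vertex `a`. -/
def Avoids (s : Finset (Fin (2 * n) ×ₗ Fin 2)) (a : Fin (2 * n) ×ₗ Fin 2) : Prop :=
  ∀ b ∈ s, pair (base b) ≠ pair (base a)

variable {s : Finset (Fin (2 * n) ×ₗ Fin 2)} {a : Fin (2 * n) ×ₗ Fin 2}

theorem Avoids.flipVertex (h : Avoids s a) : Avoids s (flipVertex a) := by
  intro b hb
  rw [base_flipVertex, pair_flip]
  exact h b hb

theorem Avoids.notMem (h : Avoids s a) : a ∉ s := fun ha => h a ha rfl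

theorem Avoids.posSign_flipVertex (h : Avoids s a) :
    posSign s (Octa.flipVertex a) = posSign s a := by
  refine posSign_congr fun b hb => ?_
  have := h b hb
  obtain ⟨u, rfl | rfl⟩ := lo_or_hi a <;> obtain ⟨v, rfl | rfl⟩ := lo_or_hi b <;>
    simp only [base_lo, base_hi] at this <;> simp [lt_flip_iff this, le_flip_iff this]

theorem support_insert (s : Finset (Fin (2 * n) ×ₗ Fin 2)) (a : Fin (2 * n) ×ₗ Fin 2) :
    support (insert a s) = insert (base a) (support s) := by
  obtain ⟨u, rfl | rfl⟩ := lo_or_hi a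
  · ext w; simp [mem_support, or_assoc]
  · ext w; simp [mem_support, or_left_comm]

theorem Avoids.base_notMem_support (h : Avoids s a) : base a ∉ support s := by
  intro hb
  rcases mem_support.1 hb with hb | hb
  · exact h _ hb rfl
  · exact h _ hb rfl

theorem Avoids.octaSign_flipVertex (h : Avoids s a) :
    octaSign (support (insert (Octa.flipVertex a) s)) = -octaSign (support (insert a s)) := by
  rw [support_insert, support_insert, base_flipVertex,
    octaSign_insert_flip h.base_notMem_support h.flipVertex.base_notMem_support]

theorem Avoids.card_insert_flipVertex (h : Avoids s a) :
    (insert (Octa.flipVertex a) s).card = (insert a s).card := by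
  rw [Finset.card_insert_of_notMem h.notMem, Finset.card_insert_of_notMem h.flipVertex.notMem]

theorem Avoids.card_slice_insert_flipVertex (h : Avoids s a) :
    (slice 0 (insert (Octa.flipVertex a) s)).card = (slice 0 (insert a s)).card := by
  have h1 := h.notMem
  have h2 := h.flipVertex.notMem
  obtain ⟨u, rfl | rfl⟩ := lo_or_hi a
  · rw [flipVertex_lo] at h2 ⊢
    rw [slice_zero_insert_lo, slice_zero_insert_lo,
      Finset.card_insert_of_notMem (by simpa using h2),
      Finset.card_insert_of_notMem (by simpa using h1)]
  · rw [flipVertex_hi, slice_zero_insert_hi, slice_zero_insert_hi]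

theorem Avoids.isCell_insert_flipVertex (h : Avoids s a) (hc : IsCell (insert a s)) :
    IsCell (insert (Octa.flipVertex a) s) := by
  constructor
  · intro u hu v hv
    have h0 := hc.1
    obtain ⟨w, rfl | rfl⟩ := lo_or_hi a
    · simp only [flipVertex_lo, Finset.mem_insert, lo_inj, hi_ne_lo, false_or] at hu hv h0
      rcases hu with rfl | hu
      · exact (flip_le_iff (h _ hv)).2 (h0 w (Or.inl rfl) v hv)
      · exact h0 u (Or.inr hu) v hv
    · simp only [flipVertex_hi, Finset.mem_insert, hi_inj, lo_ne_hi, false_or] at hu hv h0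
      rcases hv with rfl | hv
      · exact (le_flip_iff (h _ hu)).2 (h0 u hu w (Or.inl rfl))
      · exact h0 u hu v (Or.inr hv)
  · have hav : ∀ v ∈ support s, pair v ≠ pair (base (Octa.flipVertex a)) := by
      intro v hv
      rcases mem_support.1 hv with hv | hv
      · exact h.flipVertex _ hv
      · exact h.flipVertex _ hv
    intro v hv w hw hvw
    rw [support_insert, Finset.mem_insert] at hv hw
    have hp : pair v = pair w := Fin.ext hvw
    rcases hv with rfl | hv <;> rcases hw with rfl | hw
    · rfl
    · exact absurd hp.symm (hav w hw)
    · exact absurd hp (hav v hv)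
    · exact hc.2 v (by simp [support_insert, hv]) w (by simp [support_insert, hw]) hvw

/-- Exchanging the two vertices of a pair cancels the terms of a boundary. -/
theorem sum_posSign_eq_zero (G : Fin (2 * n) ×ₗ Fin 2 → ℂ)
    (hG : ∀ a, a ∉ s → G a ≠ 0 → Avoids s a ∧ G (flipVertex a) = -G a) :
    ∑ a ∈ sᶜ, (posSign s a : ℂ) * G a = 0 := by
  classical
  rw [← Finset.sum_filter_of_ne (p := fun a => G a ≠ 0)]
  swap
  · exact fun a _ h => right_ne_zero_of_mul h
  refine Finset.sum_involution (fun a _ => flipVertex a) ?_ ?_ ?_ ?_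
  · intro a ha
    rw [Finset.mem_filter, Finset.mem_compl] at ha
    obtain ⟨h1, h2⟩ := hG a ha.1 ha.2
    rw [h1.posSign_flipVertex, h2]
    ring
  · exact fun a _ _ => flipVertex_ne a
  · intro a ha
    rw [Finset.mem_filter, Finset.mem_compl] at ha ⊢
    obtain ⟨h1, h2⟩ := hG a ha.1 ha.2
    exact ⟨h1.flipVertex.notMem, by rw [h2]; exact neg_ne_zero.2 ha.2⟩
  · exact fun a _ => flipVertex_flipVertex a

/-- A vertex that extends `s` to a cell without creating a doubled vertex lies over a pair that
is missing in `s`. -/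
theorem IsCell.avoids_of_insert (hc : IsCell (insert a s)) (ha : a ∉ s)
    (h : ∀ v, lo v ∈ insert a s → hi v ∈ insert a s → lo v ∈ s ∧ hi v ∈ s) : Avoids s a := by
  intro b hb hp
  have hbase : base b = base a := by
    refine hc.injOn_pair ?_ ?_ hp
    · rw [Finset.mem_coe, mem_support]
      obtain ⟨u, rfl | rfl⟩ := lo_or_hi b
      · exact Or.inl (Finset.mem_insert_of_mem hb)
      · exact Or.inr (Finset.mem_insert_of_mem hb)
    · simp [support_insert]
  obtain ⟨u, rfl | rfl⟩ := lo_or_hi a <;> obtain ⟨v, rfl | rfl⟩ := lo_or_hi b <;>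
    simp only [base_lo, base_hi] at hbase <;> subst hbase
  · exact ha hb
  · exact ha (h v (by simp) (by simp [hb])).1
  · exact ha (h v (by simp [hb]) (by simp)).2
  · exact ha hb

end Flip

/-! ### The boundary of the sum of all `n`-simplices -/

section TopSum

variable {n : ℕ}

open Classical in
theorem coef_topSum {o : Finset (Fin (2 * n) ×ₗ Fin 2) → ℤˣ} (ho : IsLayerOrientation n o)
    (hn : 1 ≤ n) (t : Finset (Fin (2 * n) ×ₗ Fin 2)) : coef (topSum n o) t =
      if IsCell t ∧ t.card = n + 1 then
        ((octaSign (support t) : ℤ) : ℂ) * (-1) ^ (slice 0 t).card else 0 := by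
  split_ifs with h
  · obtain ⟨r, rfl⟩ : ∃ r : Simplex (glued n) (n : ℤ), r.1 = t :=
      ⟨⟨t, mem_glued_or_empty.2 h.1, by rw [h.2]; push_cast; rfl⟩, rfl⟩
    rw [topSum, coef_sum_ket (fun t => ((o t : ℤ) : ℂ)), ho.eq_of_top hn h.1 h.2]
    push_cast
    rfl
  · refine coef_of_not _ fun h' => h ⟨mem_glued_or_empty.1 h'.1, ?_⟩
    exact_mod_cast h'.2

theorem sum_compl_eq (s : Finset (Fin (2 * n) ×ₗ Fin 2)) (f : Fin (2 * n) ×ₗ Fin 2 → ℂ) :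
    ∑ a ∈ sᶜ, f a = ∑ u ∈ (slice 0 s)ᶜ, f (lo u) + ∑ u ∈ (slice 1 s)ᶜ, f (hi u) := by
  have h : sᶜ = (slice 0 s)ᶜ.image lo ∪ (slice 1 s)ᶜ.image hi := by
    ext a
    obtain ⟨v, rfl | rfl⟩ := lo_or_hi a <;> simp
  rw [h, Finset.sum_union, Finset.sum_image fun _ _ _ _ => lo_inj.1,
    Finset.sum_image fun _ _ _ _ => hi_inj.1]
  rw [Finset.disjoint_left]
  intro a ha hb
  rw [Finset.mem_image] at ha hb
  obtain ⟨v, -, rfl⟩ := ha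
  obtain ⟨w, -, h⟩ := hb
  exact hi_ne_lo _ _ h

/-- A vertex that extends `s` to an `n`-simplex is a second copy of a vertex of `s`. -/
theorem IsHat.base_mem_support {s : Finset (Fin (2 * n) ×ₗ Fin 2)} (hs : IsHat s)
    {a : Fin (2 * n) ×ₗ Fin 2} (ht : IsCell (insert a s)) : base a ∈ support s := by
  by_contra h
  have h1 := ht.card_support_le
  rw [support_insert, Finset.card_insert_of_notMem h, hs.card_support] at h1
  omega

/-- The only coface of `s` by an unprimed vertex doubles its least primed vertex; `s` inherits from
it the orientation opposite to that of the octahedron. -/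
theorem IsHat.sum_lo {s : Finset (Fin (2 * n) ×ₗ Fin 2)} (hs : IsHat s)
    {o : Finset (Fin (2 * n) ×ₗ Fin 2) → ℤˣ} (ho : IsLayerOrientation n o) (hn : 1 ≤ n) :
    ∑ u ∈ (slice 0 s)ᶜ, (posSign s (lo u) : ℂ) * coef (topSum n o) (insert (lo u) s) =
      if slice 1 s = ∅ then 0 else -((octaSign (support s) : ℤ) : ℂ) := by
  have hmem : ∀ u ∈ (slice 0 s)ᶜ, IsCell (insert (lo u) s) →
      hi u ∈ s ∧ ∀ w, hi w ∈ s → u ≤ w := by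
    intro u hu ht
    rw [Finset.mem_compl, mem_slice_zero] at hu
    refine ⟨?_, fun w hw => ht.1 u (by simp) w (by simp [hw])⟩
    have := hs.base_mem_support ht
    rw [base_lo, mem_support] at this
    exact this.resolve_left hu
  split_ifs with h
  · refine Finset.sum_eq_zero fun u hu => ?_
    rw [coef_topSum ho hn, if_neg, mul_zero]
    rintro ⟨ht, -⟩
    have := mem_slice_one.2 (hmem u hu ht).1
    rw [h] at this
    simp at this
  · have hne := Finset.nonempty_iff_ne_empty.2 h
    have hv := Finset.min'_mem _ hne
    have hmin : ∀ w, hi w ∈ s → (slice 1 s).min' hne ≤ w :=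
      fun w hw => Finset.min'_le _ _ (mem_slice_one.2 hw)
    generalize (slice 1 s).min' hne = v at hv hmin
    rw [mem_slice_one] at hv
    obtain ⟨hv0, ht, hc⟩ := hs.insert_lo hv hmin
    rw [Finset.sum_eq_single v]
    · have h0 : lo v ∈ insert (lo v) s := Finset.mem_insert_self _ _
      have h1 : hi v ∈ insert (lo v) s := Finset.mem_insert_of_mem hv
      have hpos := ht.posSign_lo h0 h1
      rw [posSign_insert hv0, if_neg (lt_irrefl _), one_mul] at hpos
      have hsupp := support_erase_lo h1
      rw [Finset.erase_insert hv0] at hsupp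
      rw [coef_topSum ho hn, if_pos ⟨ht, hc⟩, hpos, ← hsupp]
      push_cast
      have : ((-1 : ℂ) ^ (slice 0 (insert (lo v) s)).card) *
          (-1) ^ (slice 0 (insert (lo v) s)).card = 1 := by
        rw [← mul_pow]; simp
      linear_combination (-((octaSign (support s) : ℤ) : ℂ)) * this
    · intro u hu huv
      rw [coef_topSum ho hn, if_neg, mul_zero]
      rintro ⟨ht, -⟩
      obtain ⟨h1, h2⟩ := hmem u hu ht
      exact huv (le_antisymm (h2 v hv) (hmin u h1))
    · intro h
      simp [hv0] at h

/-- The only coface of `s` by a primed vertex doubles its greatest unprimed vertex; `s` inherits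
from it the orientation of the octahedron. -/
theorem IsHat.sum_hi {s : Finset (Fin (2 * n) ×ₗ Fin 2)} (hs : IsHat s)
    {o : Finset (Fin (2 * n) ×ₗ Fin 2) → ℤˣ} (ho : IsLayerOrientation n o) (hn : 1 ≤ n) :
    ∑ u ∈ (slice 1 s)ᶜ, (posSign s (hi u) : ℂ) * coef (topSum n o) (insert (hi u) s) =
      if slice 0 s = ∅ then 0 else ((octaSign (support s) : ℤ) : ℂ) := by
  have hmem : ∀ u ∈ (slice 1 s)ᶜ, IsCell (insert (hi u) s) →
      lo u ∈ s ∧ ∀ w, lo w ∈ s → w ≤ u := by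
    intro u hu ht
    rw [Finset.mem_compl, mem_slice_one] at hu
    refine ⟨?_, fun w hw => ht.1 w (by simp [hw]) u (by simp)⟩
    have := hs.base_mem_support ht
    rw [base_hi, mem_support] at this
    exact this.resolve_right hu
  split_ifs with h
  · refine Finset.sum_eq_zero fun u hu => ?_
    rw [coef_topSum ho hn, if_neg, mul_zero]
    rintro ⟨ht, -⟩
    have := mem_slice_zero.2 (hmem u hu ht).1
    rw [h] at this
    simp at this
  · have hne := Finset.nonempty_iff_ne_empty.2 h
    have hv := Finset.max'_mem _ hne
    have hmax : ∀ w, lo w ∈ s → w ≤ (slice 0 s).max' hne :=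
      fun w hw => Finset.le_max' _ _ (mem_slice_zero.2 hw)
    generalize (slice 0 s).max' hne = v at hv hmax
    rw [mem_slice_zero] at hv
    obtain ⟨hv1, ht, hc⟩ := hs.insert_hi hv hmax
    rw [Finset.sum_eq_single v]
    · have h1 : hi v ∈ insert (hi v) s := Finset.mem_insert_self _ _
      have h0 : lo v ∈ insert (hi v) s := Finset.mem_insert_of_mem hv
      have hpos := ht.posSign_hi h0 h1
      rw [posSign_insert hv1, if_neg (lt_irrefl _), one_mul] at hpos
      have hsupp := support_erase_hi h0
      rw [Finset.erase_insert hv1] at hsupp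
      rw [coef_topSum ho hn, if_pos ⟨ht, hc⟩, hpos, ← hsupp]
      push_cast
      have : ((-1 : ℂ) ^ (slice 0 (insert (hi v) s)).card) *
          (-1) ^ (slice 0 (insert (hi v) s)).card = 1 := by
        rw [← mul_pow]; simp
      linear_combination ((octaSign (support s) : ℤ) : ℂ) * this
    · intro u hu huv
      rw [coef_topSum ho hn, if_neg, mul_zero]
      rintro ⟨ht, -⟩
      obtain ⟨h1, h2⟩ := hmem u hu ht
      exact huv (le_antisymm (hmax u h1) (h2 v hv))
    · intro h
      simp [hv1] at h

theorem coef_octaCycle_zero (s : Simplex (glued n) ((n : ℤ) - 1)) (hn : 1 ≤ n) :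
    coef (octaCycle n 0) s.1 =
      if slice 1 s.1 = ∅ then ((octaSign (support s.1) : ℤ) : ℂ) else 0 := by
  simp_rw [octaCycle, coef_sum, coef_smul, coef_ket]
  split_ifs with h
  · have hsupp : support s.1 = slice 0 s.1 := by rw [support, h, Finset.union_empty]
    have hcard := card_slice_add s.1
    rw [h, Finset.card_empty, add_zero] at hcard
    have hr : (slice 0 s.1 ∈ octahedron n ∨ slice 0 s.1 = ∅) ∧
        ((slice 0 s.1).card : ℤ) = (n : ℤ) - 1 + 1 := by
      have h2 := s.2.2
      rw [hcard] at h2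
      refine ⟨Or.inl ⟨Finset.card_pos.1 (by omega), ?_⟩, h2⟩
      rw [← hsupp]
      exact (mem_glued_or_empty.1 s.2.1).2
    obtain ⟨r, hr⟩ : ∃ r : Simplex (octahedron n) ((n : ℤ) - 1), r.1 = slice 0 s.1 :=
      ⟨⟨_, hr⟩, rfl⟩
    rw [Finset.sum_eq_single r]
    · rw [hr, ← eq_copy_zero h, hsupp]
      simp
    · intro b _ hb
      rw [if_neg, mul_zero]
      intro hsb
      refine hb (Subtype.ext ?_)
      rw [hr, hsb, (slice_copy_zero _).1]
    · simp
  · refine Finset.sum_eq_zero fun r _ => ?_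
    rw [if_neg, mul_zero]
    intro hsr
    exact h (by rw [hsr, (slice_copy_zero _).2])

theorem coef_octaCycle_one (s : Simplex (glued n) ((n : ℤ) - 1)) (hn : 1 ≤ n) :
    coef (octaCycle n 1) s.1 =
      if slice 0 s.1 = ∅ then ((octaSign (support s.1) : ℤ) : ℂ) else 0 := by
  simp_rw [octaCycle, coef_sum, coef_smul, coef_ket]
  split_ifs with h
  · have hsupp : support s.1 = slice 1 s.1 := by rw [support, h, Finset.empty_union]
    have hcard := card_slice_add s.1
    rw [h, Finset.card_empty, zero_add] at hcard
    have hr : (slice 1 s.1 ∈ octahedron n ∨ slice 1 s.1 = ∅) ∧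
        ((slice 1 s.1).card : ℤ) = (n : ℤ) - 1 + 1 := by
      have h2 := s.2.2
      rw [hcard] at h2
      refine ⟨Or.inl ⟨Finset.card_pos.1 (by omega), ?_⟩, h2⟩
      rw [← hsupp]
      exact (mem_glued_or_empty.1 s.2.1).2
    obtain ⟨r, hr⟩ : ∃ r : Simplex (octahedron n) ((n : ℤ) - 1), r.1 = slice 1 s.1 :=
      ⟨⟨_, hr⟩, rfl⟩
    rw [Finset.sum_eq_single r]
    · rw [hr, ← eq_copy_one h, hsupp]
      simp
    · intro b _ hb
      rw [if_neg, mul_zero]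
      intro hsb
      refine hb (Subtype.ext ?_)
      rw [hr, hsb, (slice_copy_one _).1]
    · simp
  · refine Finset.sum_eq_zero fun r _ => ?_
    rw [if_neg, mul_zero]
    intro hsr
    exact h (by rw [hsr, (slice_copy_one _).2])

theorem boundary_topSum {o : Finset (Fin (2 * n) ×ₗ Fin 2) → ℤˣ} (ho : IsLayerOrientation n o)
    (hn : 1 ≤ n) :
    boundary (glued n) (n : ℤ) ((n : ℤ) - 1) (topSum n o) = octaCycle n 0 - octaCycle n 1 := by
  refine chain_ext fun s => ?_
  rw [coef_boundary (by ring), coef_sub, coef_octaCycle_zero s hn, coef_octaCycle_one s hn]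
  have hcell := mem_glued_or_empty.1 s.2.1
  have hcard : s.1.card = n := by
    have := s.2.2
    omega
  by_cases hs : IsHat s.1
  · rw [sum_compl_eq s.1 fun a => (posSign s.1 a : ℂ) * coef (topSum n o) (insert a s.1),
      hs.sum_lo ho hn, hs.sum_hi ho hn]
    split_ifs <;> ring
  · -- A doubled vertex leaves a pair without a vertex of `s`; both ways to fill it cancel.
    obtain ⟨v, hv0, hv1⟩ : ∃ v, lo v ∈ s.1 ∧ hi v ∈ s.1 := by
      by_contra hcon
      push Not at hcon
      exact hs ⟨hcell, hcard, hcon⟩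
    rw [if_neg (Finset.ne_empty_of_mem (mem_slice_one.2 hv1)),
      if_neg (Finset.ne_empty_of_mem (mem_slice_zero.2 hv0)), sub_zero]
    refine sum_posSign_eq_zero (fun a => coef (topSum n o) (insert a s.1)) fun a ha hne => ?_
    simp only [coef_topSum ho hn] at hne ⊢
    obtain ⟨ht, hc⟩ : IsCell (insert a s.1) ∧ (insert a s.1).card = n + 1 := by
      by_contra hcon
      exact hne (if_neg hcon)
    have hav : Avoids s.1 a := by
      refine ht.avoids_of_insert ha fun w hw0 hw1 => ?_
      have := ht.doubled_unique (Finset.mem_insert_of_mem hv0) (Finset.mem_insert_of_mem hv1)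
        hw0 hw1
      subst this
      exact ⟨hv0, hv1⟩
    refine ⟨hav, ?_⟩
    have hcard' : (insert (flipVertex a) s.1).card = n + 1 := by
      rw [hav.card_insert_flipVertex, hc]
    rw [if_pos (And.intro (hav.isCell_insert_flipVertex ht) hcard'), if_pos (And.intro ht hc),
      hav.octaSign_flipVertex, hav.card_slice_insert_flipVertex]
    push_cast
    ring

end TopSum

/-! ### The harmonic chain -/

section Harmonic

variable {n : ℕ}

theorem IsHat.isSimplex {s : Finset (Fin (2 * n) ×ₗ Fin 2)} (hs : IsHat s) :
    (s ∈ glued n ∨ s = ∅) ∧ (s.card : ℤ) = (n : ℤ) - 1 + 1 :=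
  ⟨mem_glued_or_empty.2 hs.1, by rw [hs.2.1]; ring⟩

open Classical in
theorem coef_harmonic {o : Finset (Fin (2 * n) ×ₗ Fin 2) → ℤˣ} (ho : IsLayerOrientation n o)
    (hn : 1 ≤ n) (s : Finset (Fin (2 * n) ×ₗ Fin 2)) : coef (harmonic n o) s =
      if IsHat s then ((octaSign (support s) : ℤ) : ℂ) else 0 := by
  by_cases h : (s ∈ glued n ∨ s = ∅) ∧ (s.card : ℤ) = (n : ℤ) - 1 + 1
  swap
  · rw [coef_of_not _ h, if_neg fun hs => h (hs.isSimplex)]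
  obtain ⟨r, rfl⟩ : ∃ r : Simplex (glued n) ((n : ℤ) - 1), r.1 = s := ⟨⟨s, h⟩, rfl⟩
  have hk : ∀ k ∈ Finset.range (n + 1), (∑ s ∈ hatLayer n k,
      coef (((o s : ℤ) : ℂ) • ket (glued n) ((n : ℤ) - 1) s) r.1) =
      if IsHat r.1 ∧ (slice 1 r.1).card = k then ((octaSign (support r.1) : ℤ) : ℂ) else 0 := by
    intro k hk
    simp_rw [coef_smul, coef_ket, mul_ite, mul_one, mul_zero, Finset.sum_ite_eq]
    have hmem := mem_hatLayer (s := r.1) (Nat.lt_succ_iff.1 (Finset.mem_range.1 hk))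
    split_ifs with h1 h2 h2
    · rw [ho.eq_of_isHat hn k _ h2.1 h2.2]
    · exact absurd (hmem.1 h1) h2
    · exact absurd (hmem.2 h2) h1
    · rfl
  simp_rw [harmonic, coef_sum]
  rw [Finset.sum_congr rfl hk]
  by_cases hs : IsHat r.1
  · have : (slice 1 r.1).card ≤ n := by
      have h1 := card_slice_add r.1
      have h2 := hs.2.1
      omega
    simp only [hs, true_and, if_true, Finset.sum_ite_eq, Finset.mem_range]
    rw [if_pos (by omega)]
  · simp [hs]

theorem boundary_harmonic {o : Finset (Fin (2 * n) ×ₗ Fin 2) → ℤˣ} (ho : IsLayerOrientation n o)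
    (hn : 1 ≤ n) : boundary (glued n) ((n : ℤ) - 1) ((n : ℤ) - 1 - 1) (harmonic n o) = 0 := by
  refine chain_ext fun s => ?_
  rw [coef_boundary (by ring), coef_zero]
  refine sum_posSign_eq_zero (fun a => coef (harmonic n o) (insert a s.1)) fun a ha hne => ?_
  simp only [coef_harmonic ho hn] at hne ⊢
  have ht : IsHat (insert a s.1) := by
    by_contra hcon
    exact hne (if_neg hcon)
  have hav : Avoids s.1 a :=
    ht.1.avoids_of_insert ha fun v h0 h1 => absurd h1 (ht.2.2 v h0)
  have hcell := hav.isCell_insert_flipVertex ht.1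
  have hcard : (insert (flipVertex a) s.1).card = n := by rw [hav.card_insert_flipVertex, ht.2.1]
  refine ⟨hav, ?_⟩
  rw [if_pos ht, if_pos, hav.octaSign_flipVertex]
  · push_cast
    ring
  · refine ⟨hcell, hcard, ?_⟩
    -- The support has `n` elements, so no vertex is doubled.
    have h1 := card_eq_support_add_inter (insert (flipVertex a) s.1)
    have h2 := ht.card_support
    rw [support_insert, Finset.card_insert_of_notMem hav.base_notMem_support] at h2
    rw [support_insert, Finset.card_insert_of_notMem hav.flipVertex.base_notMem_support, hcard,
      h2] at h1
    have h3 : slice 0 (insert (flipVertex a) s.1) ∩ slice 1 (insert (flipVertex a) s.1) = ∅ :=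
      Finset.card_eq_zero.1 (by omega)
    intro v hv0 hv1
    have : v ∈ slice 0 (insert (flipVertex a) s.1) ∩ slice 1 (insert (flipVertex a) s.1) :=
      Finset.mem_inter.2 ⟨mem_slice_zero.2 hv0, mem_slice_one.2 hv1⟩
    rw [h3] at this
    simp at this

/-- The two faces of an `n`-simplex obtained by removing a copy of its doubled vertex have the
same coefficient and occupy consecutive positions. -/
theorem adjoint_boundary_harmonic {o : Finset (Fin (2 * n) ×ₗ Fin 2) → ℤˣ}
    (ho : IsLayerOrientation n o) (hn : 1 ≤ n) :
    LinearMap.adjoint (boundary (glued n) ((n : ℤ) - 1 + 1) ((n : ℤ) - 1)) (harmonic n o) = 0 := by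
  ext t
  rw [adjoint_boundary_apply]
  have ht := mem_glued_or_empty.1 t.2.1
  have hc : t.1.card = n + 1 := by
    have := t.2.2
    omega
  obtain ⟨v, h0, h1⟩ := ht.exists_doubled hc
  rw [Finset.sum_eq_add (lo v) (hi v) (lo_ne_hi v v), coef_harmonic ho hn, coef_harmonic ho hn,
    if_pos (ht.isHat_erase_lo hc h0 h1), if_pos (ht.isHat_erase_hi hc h0 h1),
    support_erase_lo h1, support_erase_hi h0, ht.posSign_lo h0 h1, ht.posSign_hi h0 h1]
  · push_cast
    simp
  · intro a _ ha
    rw [coef_harmonic ho hn, if_neg, mul_zero]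
    intro h
    rcases eq_of_isHat_erase h0 h1 h with h | h
    · exact ha.1 h
    · exact ha.2 h
  · exact fun h => absurd h0 h
  · exact fun h => absurd h1 h

/-- The simplex with the vertices `vertex i (x i)` in the unprimed copy of the octahedron. -/
def bottom (x : Fin n → Fin 2) : Finset (Fin (2 * n) ×ₗ Fin 2) :=
  Finset.univ.image fun i => lo (vertex i (x i))

theorem isHat_bottom (x : Fin n → Fin 2) : IsHat (bottom x) := by
  have h0 : ∀ u, lo u ∈ bottom x ↔ ∃ i : Fin n, (i : ℕ) < n ∧ vertex i (x i) = u := by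
    intro u
    simp [bottom]
  have h1 : ∀ u, hi u ∈ bottom x ↔ ∃ i : Fin n, n ≤ (i : ℕ) ∧ vertex i (x i) = u := by
    intro u
    simp [bottom]
  obtain ⟨hc, h2, h3⟩ := isCell_of_threshold x le_rfl le_rfl (by omega) h0 h1
  refine ⟨hc, by rw [card_slice_add]; omega, ?_⟩
  intro v _ hv
  simp [bottom] at hv

theorem exists_eq_bottom {s : Finset (Fin (2 * n) ×ₗ Fin 2)} (hs : IsCell s) (hc : s.card = n)
    (h : slice 1 s = ∅) : ∃ x, s = bottom x := by
  have hhi : ∀ u, hi u ∉ s := by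
    intro u hu
    have := mem_slice_one.2 hu
    rw [h] at this
    simp at this
  have hhat : IsHat s := ⟨hs, hc, fun v _ => hhi v⟩
  obtain ⟨x, hx⟩ := hs.exists_choice hhat.card_support
  refine ⟨x, eq_of_lo_hi (fun u => ?_) (fun u => ?_)⟩
  · have := hx u
    rw [mem_support, or_iff_left (hhi u)] at this
    rw [this]
    simp [bottom]
  · simp [bottom, hhi u]

theorem bottom_eq_insert (x : Fin n → Fin 2) (j : Fin n) (b : Fin 2) :
    bottom (Function.update x j b) =
      insert (lo (vertex j b)) ((Finset.univ.erase j).image fun i => lo (vertex i (x i))) := by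
  rw [bottom, ← Finset.insert_erase (Finset.mem_univ j), Finset.image_insert]
  simp only [Function.update_self]
  congr 1
  rw [Finset.insert_erase (Finset.mem_univ j)]
  refine Finset.image_congr fun i hi => ?_
  rw [Finset.mem_coe, Finset.mem_erase] at hi
  rw [Function.update_of_ne hi.1]

/-- A cycle on the unprimed copy that vanishes at one maximal simplex vanishes: two maximal
simplices differing in one pair are the only cofaces of their intersection, and all maximal
simplices are connected in this way. -/
theorem unprimed_cycle_eq_zero {w : Chain (glued n) ((n : ℤ) - 1)}
    (h0 : boundary (glued n) ((n : ℤ) - 1) ((n : ℤ) - 1 - 1) w = 0)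
    (hu : ∀ s, (slice 1 s).Nonempty → coef w s = 0) (x₀ : Fin n → Fin 2)
    (hx₀ : coef w (bottom x₀) = 0) : w = 0 := by
  have step : ∀ x : Fin n → Fin 2, coef w (bottom x) = 0 → ∀ j b,
      coef w (bottom (Function.update x j b)) = 0 := by
    intro x hx j b
    by_cases hb : b = x j
    · rwa [hb, Function.update_eq_self]
    have hx' := bottom_eq_insert x j (x j)
    rw [Function.update_eq_self] at hx'
    rw [hx'] at hx
    rw [bottom_eq_insert]
    have hsum := coef_boundary (show (n : ℤ) - 1 = (n : ℤ) - 1 - 1 + 1 by ring) w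
      ((Finset.univ.erase j).image fun i => lo (vertex i (x i)))
    rw [h0, coef_zero, Finset.sum_eq_single (lo (vertex j b))] at hsum
    · exact (mul_eq_zero.1 hsum.symm).resolve_left (by exact_mod_cast posSign_ne_zero _ _)
    · intro a ha hab
      refine mul_eq_zero_of_right _ ?_
      obtain ⟨u, rfl | rfl⟩ := lo_or_hi a
      · obtain ⟨c, hc⟩ := eq_vertex_pair u
        by_cases hp : pair u = j
        · rw [hp] at hc
          have : c = x j := by
            have : c ≠ b := fun h => hab (by rw [hc, h])
            omega
          rwa [hc, this]
        · refine coef_of_not _ fun h => ?_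
          have hcell := mem_glued_or_empty.1 h.1
          have hmem : lo (vertex (pair u) (x (pair u))) ∈
              (Finset.univ.erase j).image fun i => lo (vertex i (x i)) :=
            Finset.mem_image.2 ⟨pair u, by simp [hp], rfl⟩
          have : vertex (pair u) (x (pair u)) = u :=
            hcell.injOn_pair (mem_support.2 (Or.inl (Finset.mem_insert_of_mem hmem)))
              (mem_support.2 (Or.inl (Finset.mem_insert_self _ _))) (pair_vertex _ _)
          rw [this] at hmem
          exact (Finset.mem_compl.1 ha) hmem
      · exact hu _ ⟨u, by simp⟩
    · intro h
      exfalso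
      refine h (Finset.mem_compl.2 fun h => ?_)
      obtain ⟨i, hi, hij⟩ := Finset.mem_image.1 h
      have := congrArg pair (lo_inj.1 hij)
      rw [pair_vertex, pair_vertex] at this
      exact (Finset.mem_erase.1 hi).1 this
  have hall : ∀ y : Fin n → Fin 2, ∀ S : Finset (Fin n),
      coef w (bottom (S.piecewise y x₀)) = 0 := by
    intro y S
    induction S using Finset.induction_on with
    | empty => simpa using hx₀
    | insert j S _ ih =>
      rw [Finset.piecewise_insert]
      exact step _ ih j (y j)
  refine chain_ext fun s => ?_
  rw [coef_zero]
  rcases (slice 1 s.1).eq_empty_or_nonempty with h | h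
  · obtain ⟨y, hy⟩ := exists_eq_bottom (mem_glued_or_empty.1 s.2.1)
      (by have := s.2.2; omega) h
    have := hall y Finset.univ
    rwa [Finset.piecewise_univ, ← hy] at this
  · exact hu _ h

theorem harmonic_ne_zero {o : Finset (Fin (2 * n) ×ₗ Fin 2) → ℤˣ} (ho : IsLayerOrientation n o)
    (hn : 1 ≤ n) : harmonic n o ≠ 0 := by
  intro h
  have := coef_harmonic ho hn (bottom fun _ => 0)
  rw [h, coef_zero, if_pos (isHat_bottom _)] at this
  exact (Units.ne_zero _) (by exact_mod_cast this.symm)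

/-- Up to a scalar, a kernel element and the harmonic chain are homologous to the same cycle on the
unprimed copy, so some combination of them is both a boundary and orthogonal to all boundaries. -/
theorem ker_laplacian_glued {o : Finset (Fin (2 * n) ×ₗ Fin 2) → ℤˣ}
    (ho : IsLayerOrientation n o) (hn : 1 ≤ n) :
    Submodule.span ℂ {harmonic n o} = LinearMap.ker (laplacian (glued n) ((n : ℤ) - 1)) := by
  rw [ker_laplacian]
  refine le_antisymm ?_ ?_
  · rw [Submodule.span_singleton_le_iff_mem]
    exact ⟨adjoint_boundary_harmonic ho hn, boundary_harmonic ho hn⟩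
  rintro ψ ⟨hψδ, hψb⟩
  rw [SetLike.mem_coe, LinearMap.mem_ker] at hψδ hψb
  have hde : (n : ℤ) - 1 = (n : ℤ) - 1 - 1 + 1 := by ring
  obtain ⟨w, hw, hwu, hwB⟩ := exists_unprimed_cycle hde (boundary_harmonic ho hn)
  obtain ⟨z, hz, hzu, hzB⟩ := exists_unprimed_cycle hde hψb
  -- The unprimed cycles homologous to the harmonic chain and to `ψ` are compared at one simplex.
  have hcw : coef w (bottom fun _ => 0) ≠ 0 := by
    intro h
    have hw0 := unprimed_cycle_eq_zero hw hwu _ h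
    rw [hw0, sub_zero] at hwB
    exact harmonic_ne_zero ho hn
      (eq_zero_of_mem_range_boundary hwB (adjoint_boundary_harmonic ho hn))
  set c := coef z (bottom fun _ => 0) / coef w (bottom fun _ => 0) with hc
  have hzw : z - c • w = 0 := by
    refine unprimed_cycle_eq_zero (x₀ := fun _ => 0) ?_ ?_ ?_
    · rw [map_sub, map_smul, hw, hz, smul_zero, sub_zero]
    · intro s hs
      rw [coef_sub, coef_smul, hwu s hs, hzu s hs, mul_zero, sub_zero]
    · rw [coef_sub, coef_smul, hc, div_mul_cancel₀ _ hcw, sub_self]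
  have hψφ : ψ - c • harmonic n o = 0 := by
    refine eq_zero_of_mem_range_boundary (d := (n : ℤ) - 1 + 1) ?_ ?_
    · have : ψ - c • harmonic n o = (ψ - z) - c • (harmonic n o - w) := by
        rw [sub_eq_zero.1 hzw, smul_sub]
        abel
      rw [this]
      exact Submodule.sub_mem _ hzB (Submodule.smul_mem _ _ hwB)
    · rw [map_sub, map_smul, hψδ, adjoint_boundary_harmonic ho hn, smul_zero, sub_zero]
  exact Submodule.mem_span_singleton.2 ⟨c, (sub_eq_zero.1 hψφ).symm⟩

end Harmonic

end Octa

theorem mainTheorem5 (n : ℕ) (hn : 1 ≤ n) :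
    (∃ o : Finset (Fin (2 * n) ×ₗ Fin 2) → ℤˣ, Octa.IsLayerOrientation n o) ∧
      ∀ o : Finset (Fin (2 * n) ×ₗ Fin 2) → ℤˣ, Octa.IsLayerOrientation n o →
        Octa.boundary (Octa.glued n) (n : ℤ) ((n : ℤ) - 1) (Octa.topSum n o) =
            Octa.octaCycle n 0 - Octa.octaCycle n 1 ∧
          Submodule.span ℂ {Octa.harmonic n o} =
            LinearMap.ker (Octa.laplacian (Octa.glued n) ((n : ℤ) - 1)) :=
  ⟨⟨Octa.stdSign, Octa.isLayerOrientation_stdSign n⟩, fun _ ho =>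
    ⟨Octa.boundary_topSum ho hn, Octa.ker_laplacian_glued ho hn⟩⟩
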